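/- Let $P$ be an irreducible stochastic matrix on $\mathcal X=\{1,\dots,n\}$ (in particular, $P$ may be the transition matrix of any ergodic chain) with stationary distribution $q$, let $c\in\mathbb R^n$, $\alpha\in(0,1)$, and let $\Phi\in\mathbb R^{n\times m}$ have rows $\varphi(i)^\top$, $i\in\mathcal X$ ($\Phi$ need not have full column rank). Let $\sigma_i(p,v)$ be a transition risk mapping: for each state $i$ and each probability vector $p$ on $\mathcal X$, the function $\sigma_i(p,\cdot):\mathbb R^n\to\mathbb R$ is convex, monotone (for the componentwise order), translation equivariant ($\sigma_i(p,v+\beta\mathbf 1)=\sigma_i(p,v)+\beta$, $\beta\in\mathbb R$), and positively homogeneous ($\sigma_i(p,\beta v)=\beta\sigma_i(p,v)$, $\beta\ge0$). Write $P_i$ for the $i$-th row of $P$, $p_{ij}$ for its entries, $\sigma(P,v)=(\sigma_i(P_i,v))_{i\in\mathcal X}$, and let $A_i=\{\mu \text{ a probability vector on } \mathcal X:\ \langle\mu,v\rangle\le\sigma_i(P_i,v)\ \ \forall v\in\mathbb R^n\}$, so that $\sigma_i(P_i,v)=\max_{\mu\in A_i}\langle\mu,v\rangle$. Suppose that every $\mu\in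 A_i$ is absolutely continuous with respect to $P_i$, for all $i$. Put $$\varkappa=\max\Big\{\frac{|\mu_j-p_{ij}|}{p_{ij}}:\ i,j\in\mathcal X,\ \mu\in A_i,\ p_{ij}>0\Big\},$$ and assume $\alpha\sqrt{1+\varkappa}<1$. Let $\|w\|_q^2=\sum_i q_iw_i^2$ and let $L$ be the projection on $\mathrm{range}(\Phi)$ in the norm $\|\cdot\|_q$. On a probability space let $i_t\in\mathcal X$, $r_t\in\mathbb R^m$ and real random variables $\gamma_t,\xi_t,\widetilde\sigma_t$, $t=0,1,2,\dots$, be given, and let $\mathcal F_t$ be the $\sigma$-algebra generated by $i_0,r_0,\dots,i_t,r_t$. Assume: 1. $\mathbb P(i_{t+1}=j\mid\mathcal F_t)=p_{i_tj}$ a.s. for all $t$ and $j$. 2. $\widetilde\sigma_t=\sigma_{i_t}(P_{i_t},\Phi r_t)+\xi_t$, where $\xi_t$ is square integrable, $\mathbb E[\xi_t\mid\mathcal F_t]=0$ and $\mathbb E[\xi_t^2\mid\mathcal F_t]\le K$ a.s. for all $t$, with a constant $K$ independent of $t$. 3. $\gamma_t$ is $\mathcal F_t$-measurable; almost surely $\gamma_t>0$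 for all $t$, $\gamma_t\to0$ and $\sum_t\gamma_t=\infty$; $\mathbb E\sum_t\gamma_t^2<\infty$; and for every $\varepsilon>0$, $$\lim_{t_0\to\infty}\ \sup_{\{T:\ \sum_{t=t_0}^T\gamma_t\le\varepsilon\}}\ \sum_{t=t_0}^T|\gamma_t-\gamma_{t+1}|=0\quad\text{a.s.}$$ Put $\widetilde d_t=\varphi(i_t)^\top r_t-c(i_t)-\alpha\widetilde\sigma_t$. Then the equation $v=L\big(c+\alpha\,\sigma(P,v)\big)$ has a unique solution $v^*\in\mathbb R^n$, and the following holds. (a) If $r_{t+1}=r_t-\gamma_t\varphi(i_t)\widetilde d_t$ for all $t$ and the sequence $\{r_t\}$ is bounded almost surely, then almost surely every accumulation point of $\{r_t\}$ belongs to $Y^*=\{r\in\mathbb R^m:\Phi r=v^*\}$. (b) Let $Y\subset\mathbb R^m$ be a closed, convex, bounded set such that $Y^*=\{r\in Y:\Phi r=v^*\}$ is nonempty. If $r_{t+1}=\mathrm{Proj}_Y\big(r_t-\gamma_t\varphi(i_t)\widetilde d_t\big)$ for all $t$, with $\mathrm{Proj}_Y$ the Euclidean projection on $Y$, then almost surely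 every accumulation point of $\{r_t\}$ belongs to $Y^*$. -/

import Mathlib

open MeasureTheory ProbabilityTheory Filter Topology
open scoped Matrix

namespace RiskTD

noncomputable section

/-- `x` minimizes the real function `f` over the set `S`. -/
def IsArgmin {E : Type*} (f : E → ℝ) (S : Set E) (x : E) : Prop :=
  x ∈ S ∧ ∀ z ∈ S, f x ≤ f z

/-- Axioms of a coherent measure of risk on the functions on `{1, …, n}`. -/
structure IsCoherent {n : ℕ} (ρ : (Fin n → ℝ) → ℝ) : Prop where
  convexity : ∀ (v w : Fin n → ℝ) (a : ℝ), 0 ≤ a → a ≤ 1 →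
    ρ (a • v + (1 - a) • w) ≤ a * ρ v + (1 - a) * ρ w
  monotonicity : ∀ v w : Fin n → ℝ, v ≤ w → ρ v ≤ ρ w
  translation : ∀ (v : Fin n → ℝ) (b : ℝ), ρ (v + fun _ => b) = ρ v + b
  homogeneity : ∀ (v : Fin n → ℝ) (b : ℝ), 0 ≤ b → ρ (b • v) = b * ρ v

/-- A transition risk mapping `σ i p v` (state `i`, distribution `p` of the next state, function `v`
of the next state): for every state and every distribution it is coherent in its last argument. -/
def IsTransitionRiskMapping {n : ℕ} (σ : Fin n → (Fin n → ℝ) → (Fin n → ℝ) → ℝ) : Prop :=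
  ∀ i, ∀ p ∈ stdSimplex ℝ (Fin n), IsCoherent (σ i p)

/-- The transition risk operator `σ(P, v)`, with components `σ_i(P_i, v)`. -/
def riskOp {n : ℕ} (σ : Fin n → (Fin n → ℝ) → (Fin n → ℝ) → ℝ)
    (P : Matrix (Fin n) (Fin n) ℝ) (v : Fin n → ℝ) : Fin n → ℝ :=
  fun i => σ i (P i) v

/-- The risk multikernel: the set `A_i(p)` of probability vectors in the dual representation
of `σ_i(p, ·)`, that is, the subdifferential of `σ_i(p, ·)` at `0`. -/
def riskMultikernel {n : ℕ} (σ : Fin n → (Fin n → ℝ) → (Fin n → ℝ) → ℝ)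
    (i : Fin n) (p : Fin n → ℝ) : Set (Fin n → ℝ) :=
  {μ | μ ∈ stdSimplex ℝ (Fin n) ∧ ∀ v, μ ⬝ᵥ v ≤ σ i p v}

/-- The distortion coefficient `ϰ` of the risk multikernel at the transition matrix `P`. -/
def distortion {n : ℕ} (σ : Fin n → (Fin n → ℝ) → (Fin n → ℝ) → ℝ)
    (P : Matrix (Fin n) (Fin n) ℝ) : ℝ :=
  sSup {x | ∃ i j, ∃ μ ∈ riskMultikernel σ i (P i), 0 < P i j ∧ x = |μ j - P i j| / P i j}

/-- The norm `‖w‖_q`. -/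
def qNorm {n : ℕ} (q w : Fin n → ℝ) : ℝ := Real.sqrt (∑ i, q i * w i ^ 2)

/-- `v` solves the projected risk-averse equation `v = L(c + α σ(P, v))`, where `L` is the
projection on the range of `Φ` in the norm `‖·‖_q`. -/
def IsProjectedSolution {n m : ℕ} (σ : Fin n → (Fin n → ℝ) → (Fin n → ℝ) → ℝ)
    (P : Matrix (Fin n) (Fin n) ℝ) (q c : Fin n → ℝ) (α : ℝ)
    (Φ : Matrix (Fin n) (Fin m) ℝ) (v : Fin n → ℝ) : Prop :=
  IsArgmin (fun z => qNorm q (z - (c + α • riskOp σ P v)))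
    (Set.range fun r : Fin m → ℝ => Φ *ᵥ r) v

/-- The vector `φ(i)` of features of the state `i`. -/
def feature {n m : ℕ} (Φ : Matrix (Fin n) (Fin m) ℝ) (i : Fin n) : EuclideanSpace ℝ (Fin m) :=
  WithLp.toLp 2 (Φ i)

/-- The approximate value function `Φ r`. -/
def approxValue {n m : ℕ} (Φ : Matrix (Fin n) (Fin m) ℝ) (r : EuclideanSpace ℝ (Fin m)) :
    Fin n → ℝ :=
  Φ *ᵥ r.ofLp

/-- The σ-algebra `F_t` generated by `i_0, r_0, …, i_t, r_t`. -/
def history {Ω : Type*} {n m : ℕ} (i : ℕ → Ω → Fin n) (r : ℕ → Ω → EuclideanSpace ℝ (Fin m))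
    (t : ℕ) : MeasurableSpace Ω :=
  ⨆ s : ℕ, ⨆ _ : s ≤ t, (MeasurableSpace.comap (i s) inferInstance ⊔
    MeasurableSpace.comap (r s) inferInstance)

/-- `i_0, i_1, …` evolves as a Markov chain with transition matrix `P` with respect to `F_t`:
`P(i_{t+1} = j | F_t) = P_{i_t j}`. -/
def IsMarkovTrajectory {Ω : Type*} [MeasurableSpace Ω] (μ : Measure Ω) {n : ℕ}
    (P : Matrix (Fin n) (Fin n) ℝ) (F : ℕ → MeasurableSpace Ω) (i : ℕ → Ω → Fin n) : Prop :=
  ∀ (t : ℕ) (j : Fin n),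
    μ[(i (t + 1) ⁻¹' {j}).indicator (fun _ => (1 : ℝ)) | F t] =ᵐ[μ] fun ω => P (i t ω) j

/-- The conditions on the random step sizes. -/
structure StepsizeCondition {Ω : Type*} [MeasurableSpace Ω] (μ : Measure Ω)
    (F : ℕ → MeasurableSpace Ω) (γ : ℕ → Ω → ℝ) : Prop where
  adapted : ∀ t, Measurable[F t] (γ t)
  pos : ∀ᵐ ω ∂μ, ∀ t, 0 < γ t ω
  tendsto_zero : ∀ᵐ ω ∂μ, Tendsto (fun t => γ t ω) atTop (𝓝 0)
  sum_eq_top : ∀ᵐ ω ∂μ, Tendsto (fun T => ∑ t ∈ Finset.range T, γ t ω) atTop atTop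
  sum_sq_lt_top : ∫⁻ ω, ∑' t, ENNReal.ofReal (γ t ω ^ 2) ∂μ < ⊤
  variation : ∀ ε : ℝ, 0 < ε → ∀ᵐ ω ∂μ,
    Tendsto (fun t₀ : ℕ => ⨆ T : ℕ, ⨆ _ : ∑ t ∈ Finset.Icc t₀ T, γ t ω ≤ ε,
      ENNReal.ofReal (∑ t ∈ Finset.Icc t₀ T, |γ t ω - γ (t + 1) ω|)) atTop (𝓝 0)

/-- The conditions on the errors: square integrable, conditionally centered, and with
conditional second moments bounded by one constant. -/
structure ErrorCondition {Ω : Type*} [MeasurableSpace Ω] (μ : Measure Ω)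
    (F : ℕ → MeasurableSpace Ω) (ξ : ℕ → Ω → ℝ) : Prop where
  memLp : ∀ t, MemLp (ξ t) 2 μ
  centered : ∀ t, μ[ξ t | F t] =ᵐ[μ] 0
  bounded : ∃ K : ℝ, ∀ t, ∀ᵐ ω ∂μ, (μ[fun ω' => ξ t ω' ^ 2 | F t]) ω ≤ K

/-- The observed temporal difference at the state `i`, the coefficients `r`, and the
value `s` of the estimate of the risk. -/
def tempDiff {n m : ℕ} (c : Fin n → ℝ) (α : ℝ) (Φ : Matrix (Fin n) (Fin m) ℝ)
    (i : Fin n) (r : EuclideanSpace ℝ (Fin m)) (s : ℝ) : ℝ :=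
  inner ℝ (feature Φ i) r - c i - α * s

/-- The point `r_t - γ_t φ(i_t) d̃_t`. -/
def tdStep {n m : ℕ} (c : Fin n → ℝ) (α : ℝ) (Φ : Matrix (Fin n) (Fin m) ℝ)
    (i : Fin n) (r : EuclideanSpace ℝ (Fin m)) (s γ : ℝ) : EuclideanSpace ℝ (Fin m) :=
  r - (γ * tempDiff c α Φ i r s) • feature Φ i

end

end RiskTD

/-! The projected equation is a fixed point problem for a contraction. A dual vector `μ` at one
argument bounds the difference of risks by a linear functional, Jensen's inequality moves the square
inside, absolute continuity and the definition of `ϰ` give `μ j ≤ (1 + ϰ) * P i j`, and stationarity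
sums the rows of `P` back to `q`. Hence `σ(P, ·)` is Lipschitz with constant `√(1 + ϰ)` in `‖·‖_q`,
and composing with a nonexpansive projection keeps the factor `α√(1 + ϰ) < 1`. The same estimate,
together with the orthogonality of the residual at `v*`, makes the mean temporal-difference drift
point towards the solutions (`IsProjectedSolution.drift_ge`).

The Lyapunov function is `V_t`, the squared Euclidean distance from `r_t` to the solutions in `Y`
(with `Y` the whole space for the basic method). One step changes it by at most `-2 γ_t h(i_t,
r_t)`, plus noise, plus terms of order `γ_t²`. Two disturbances have to be averaged out.

The observation error `ξ_t` is centered given `F_t` but is not assumed `F_{t+1}`-measurable, so `∑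
γ_t ξ_t` is not available as an adapted martingale. Instead, the increments of a truncated `V`,
which are adapted, are centered by their conditional expectations; the centered series converges and
the conditional expectations are bounded from above (`exists_distance_recursion`).

The difference between `h(i_t, ·)` and its stationary mean is written as `f - P f` by the Poisson
equation (`exists_poisson`). Multiplied by `γ_t`, it splits into a telescoping term, a term with
`γ_t - γ_{t+1}`, a term of second order from the change of `r_t`, and a martingale difference.

All these errors are small over windows relative to the accumulated step size. The deterministic
`tendsto_zero_of_drift` then yields `V_t → 0`. Integrability is obtained by switching the step size
off outside a fixed bound; the random bound on the trajectory is recovered through countably many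
integer bounds. -/

namespace RiskTD

/-! ### Projections on convex sets in inner product spaces. -/

section Projection

variable {E : Type*} [NormedAddCommGroup E] [InnerProductSpace ℝ E]

theorem IsArgmin.inner_le_zero {Y : Set E} (hY : Convex ℝ Y) {x p w : E}
    (h : IsArgmin (fun z => ‖z - x‖) Y p) (hw : w ∈ Y) : inner ℝ (x - p) (w - p) ≤ 0 := by
  refine (norm_eq_iInf_iff_real_inner_le_zero hY h.1).1 ?_ w hw
  have : Nonempty Y := ⟨⟨p, h.1⟩⟩
  refine le_antisymm (le_ciInf fun z => ?_)
    (ciInf_le ⟨0, Set.forall_mem_range.2 fun z : Y => norm_nonneg (x - z)⟩ ⟨p, h.1⟩)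
  rw [norm_sub_rev x p, norm_sub_rev x z]
  exact h.2 z z.2

/-- Projections on a convex set are nonexpansive. -/
theorem IsArgmin.norm_sub_le {Y : Set E} (hY : Convex ℝ Y) {x x' p p' : E}
    (h : IsArgmin (fun z => ‖z - x‖) Y p) (h' : IsArgmin (fun z => ‖z - x'‖) Y p') :
    ‖p - p'‖ ≤ ‖x - x'‖ := by
  have h1 := h.inner_le_zero hY h'.1
  have h2 := h'.inner_le_zero hY h.1
  -- Firm nonexpansiveness, the sum of the two variational inequalities; Cauchy–Schwarz finishes.
  have h3 : ‖p - p'‖ ^ 2 ≤ inner ℝ (x - x') (p - p') := by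
    have e : inner ℝ (x - x') (p - p') - ‖p - p'‖ ^ 2
        = - inner ℝ (x - p) (p' - p) - inner ℝ (x' - p') (p - p') := by
      rw [← real_inner_self_eq_norm_sq, ← inner_sub_left, ← neg_sub p p', inner_neg_right,
        neg_neg, ← inner_sub_left]
      congr 1
      abel
    linarith
  have h4 := real_inner_le_norm (x - x') (p - p')
  by_contra! hlt
  have h5 : 0 < ‖p - p'‖ := (norm_nonneg _).trans_lt hlt
  nlinarith

omit [InnerProductSpace ℝ E] in
theorem isArgmin_norm_sub_self {Y : Set E} {w : E} (hw : w ∈ Y) :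
    IsArgmin (fun z => ‖z - w‖) Y w :=
  ⟨hw, fun z _ => by simp⟩

theorem IsArgmin.norm_sub_le_of_mem {Y : Set E} (hY : Convex ℝ Y) {x p w : E}
    (h : IsArgmin (fun z => ‖z - x‖) Y p) (hw : w ∈ Y) : ‖p - w‖ ≤ ‖x - w‖ :=
  h.norm_sub_le hY (isArgmin_norm_sub_self hw)

theorem exists_isArgmin_norm_sub [CompleteSpace E] {Y : Set E} (hne : Y.Nonempty)
    (hc : IsClosed Y) (hY : Convex ℝ Y) (x : E) : ∃ p, IsArgmin (fun z => ‖z - x‖) Y p := by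
  obtain ⟨p, hp, h⟩ := exists_norm_eq_iInf_of_complete_convex hne hc.isComplete hY x
  refine ⟨p, hp, fun z hz => ?_⟩
  change ‖p - x‖ ≤ ‖z - x‖
  rw [norm_sub_rev p, norm_sub_rev z, h]
  exact ciInf_le ⟨0, Set.forall_mem_range.2 fun z : Y => norm_nonneg (x - z)⟩ ⟨z, hz⟩

end Projection

/-! ### Duality and Lipschitz continuity of coherent risk measures. -/

section Coherent

variable {n : ℕ} {ρ : (Fin n → ℝ) → ℝ}

theorem IsCoherent.map_zero (h : IsCoherent ρ) : ρ 0 = 0 := by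
  simpa using h.homogeneity 0 0 le_rfl

theorem IsCoherent.add_le (h : IsCoherent ρ) (v w : Fin n → ℝ) : ρ (v + w) ≤ ρ v + ρ w := by
  have h1 := h.convexity v w (1 / 2) (by norm_num) (by norm_num)
  have h2 := h.homogeneity ((1 / 2 : ℝ) • v + (1 - 1 / 2 : ℝ) • w) 2 (by norm_num)
  have h3 : (2 : ℝ) • ((1 / 2 : ℝ) • v + (1 - 1 / 2 : ℝ) • w) = v + w := by
    ext j; simp; ring
  rw [h3] at h2
  linarith

/-- The dual representation of a coherent risk measure, at a given point. -/
theorem IsCoherent.exists_dual (h : IsCoherent ρ) (v : Fin n → ℝ) :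
    ∃ μ ∈ stdSimplex ℝ (Fin n), (∀ w, μ ⬝ᵥ w ≤ ρ w) ∧ μ ⬝ᵥ v = ρ v := by
  have h0 := h.map_zero
  have hwd : ∀ c : ℝ, c • v = 0 → c • ρ v = 0 := by
    intro c hc
    rcases smul_eq_zero.1 hc with hc | hc
    · simp [hc]
    · simp [hc, h0]
  -- Hahn–Banach: the functional `c • v ↦ c * ρ v` on the line through `v` is dominated by the
  -- sublinear `ρ`. For `c < 0` the domination comes from `0 = ρ 0 ≤ ρ (c • v) + ρ (-c • v)`.
  let f : (Fin n → ℝ) →ₗ.[ℝ] ℝ := LinearPMap.mkSpanSingleton' v (ρ v) hwd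
  obtain ⟨g, hg, hgρ⟩ := exists_extension_of_le_sublinear f ρ
    (fun c hc x => h.homogeneity x c hc.le) h.add_le (by
      rintro ⟨x, hx⟩
      obtain ⟨c, rfl⟩ := Submodule.mem_span_singleton.1 hx
      have : f ⟨c • v, hx⟩ = c * ρ v := LinearPMap.mkSpanSingleton'_apply ..
      rw [this]
      rcases le_total 0 c with hc | hc
      · exact (h.homogeneity v c hc).ge
      · have h1 := h.homogeneity v (-c) (by linarith)
        have h2 := h.add_le (c • v) (-c • v)
        rw [← add_smul, add_neg_cancel, zero_smul, h0] at h2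
        change c * ρ v ≤ ρ (c • v)
        linarith)
  have hgv : g v = ρ v := by
    have h1 := hg ⟨v, Submodule.mem_span_singleton_self v⟩
    have h2 : f ⟨v, Submodule.mem_span_singleton_self v⟩ = ρ v :=
       LinearPMap.mkSpanSingleton'_apply_self v (ρ v) hwd _
    rw [← h2, ← h1]
  have hdot : ∀ w, (fun j => g (Pi.single j 1)) ⬝ᵥ w = g w := by
    intro w
    conv_rhs => rw [pi_eq_sum_univ' w]
    rw [map_sum]
    refine Finset.sum_congr rfl fun j _ => ?_
    rw [map_smul, smul_eq_mul, mul_comm]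
  refine ⟨fun j => g (Pi.single j 1), ⟨fun j => ?_, ?_⟩, fun w => (hdot w).trans_le (hgρ w),
    (hdot v).trans hgv⟩
  -- Monotonicity makes the weights nonnegative; translation by `1` and by `-1` makes their sum
  -- equal to one.
  · have h1 := hgρ (-Pi.single j 1)
    have h2 := h.monotonicity (-Pi.single j 1) 0 (by
      simp)
    rw [map_neg] at h1
    change 0 ≤ g (Pi.single j 1)
    linarith
  · have h1 := hgρ fun _ => 1
    have h2 := hgρ fun _ => -1
    have h3 := h.translation 0 1
    have h4 := h.translation 0 (-1)
    rw [zero_add] at h3 h4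
    have h5 : g (fun _ => -1) = - g fun _ => 1 := by
      rw [← map_neg]; congr 1
    have h6 := hdot fun _ => 1
    simp only [dotProduct, mul_one] at h6
    rw [h6]
    linarith

/-- In the sup norm `v` lies below `w` shifted by the constant `‖v - w‖`, so monotonicity and
translation equivariance suffice. -/
theorem IsCoherent.abs_sub_le_norm (h : IsCoherent ρ) (v w : Fin n → ℝ) :
    |ρ v - ρ w| ≤ ‖v - w‖ := by
  have key : ∀ v w : Fin n → ℝ, ρ v ≤ ρ w + ‖v - w‖ := by
    intro v w
    rw [← h.translation]
    refine h.monotonicity _ _ fun j => ?_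
    have := (le_abs_self _).trans (norm_le_pi_norm (v - w) j)
    simp only [Pi.add_apply, Pi.sub_apply] at this ⊢
    linarith
  rw [abs_sub_le_iff]
  have h1 := key v w
  have h2 := key w v
  rw [norm_sub_rev] at h2
  constructor <;> linarith

end Coherent

/-! ### The risk operator in the norm weighted by the stationary distribution. -/

section Contraction

variable {n : ℕ} {σ : Fin n → (Fin n → ℝ) → (Fin n → ℝ) → ℝ} {P : Matrix (Fin n) (Fin n) ℝ}

/-- Needed because the real `sSup` carries information only for bounded sets; the numerators are at
most one and there are finitely many denominators. -/
theorem bddAbove_distortion (hP : ∀ i, P i ∈ stdSimplex ℝ (Fin n)) :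
    BddAbove {x | ∃ i j, ∃ μ ∈ riskMultikernel σ i (P i), 0 < P i j ∧
      x = |μ j - P i j| / P i j} := by
  refine ⟨∑ i, ∑ j, 1 / P i j, ?_⟩
  rintro x ⟨i, j, μ, hμ, hpos, rfl⟩
  have h1 := (mem_Icc_of_mem_stdSimplex hμ.1 j)
  have h2 := (mem_Icc_of_mem_stdSimplex (hP i) j)
  have h0 : ∀ i j, 0 ≤ 1 / P i j := fun i j => one_div_nonneg.2 ((hP i).1 j)
  calc |μ j - P i j| / P i j ≤ 1 / P i j := by
        gcongr
        rw [abs_sub_le_iff]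
        constructor <;> linarith [h1.1, h1.2, h2.1, h2.2]
    _ ≤ ∑ j, 1 / P i j := Finset.single_le_sum (f := fun j => 1 / P i j)
        (fun j _ => h0 i j) (Finset.mem_univ j)
    _ ≤ ∑ i, ∑ j, 1 / P i j := Finset.single_le_sum (f := fun i => ∑ j, 1 / P i j)
        (fun i _ => Finset.sum_nonneg fun j _ => h0 i j) (Finset.mem_univ i)

theorem distortion_nonneg : 0 ≤ distortion σ P := by
  refine Real.sSup_nonneg ?_
  rintro x ⟨i, j, μ, -, hpos, rfl⟩
  positivity

theorem le_one_add_distortion_mul (hP : ∀ i, P i ∈ stdSimplex ℝ (Fin n))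
    (hac : ∀ i, ∀ μ ∈ riskMultikernel σ i (P i), ∀ j, P i j = 0 → μ j = 0)
    {i : Fin n} {μ : Fin n → ℝ} (hμ : μ ∈ riskMultikernel σ i (P i)) (j : Fin n) :
    μ j ≤ (1 + distortion σ P) * P i j := by
  rcases ((hP i).1 j).eq_or_lt with h | h
  · rw [hac i μ hμ j h.symm, ← h, mul_zero]
  · have h1 : |μ j - P i j| / P i j ≤ distortion σ P :=
      le_csSup (bddAbove_distortion hP) ⟨i, j, μ, hμ, h, rfl⟩
    rw [div_le_iff₀ h] at h1
    linarith [le_abs_self (μ j - P i j)]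

theorem sq_dotProduct_le_of_mem_stdSimplex {μ : Fin n → ℝ} (hμ : μ ∈ stdSimplex ℝ (Fin n))
    (x : Fin n → ℝ) : (μ ⬝ᵥ x) ^ 2 ≤ ∑ j, μ j * x j ^ 2 := by
  have := Real.pow_arith_mean_le_arith_mean_pow_of_even Finset.univ μ x (fun j _ => hμ.1 j) hμ.2
    (n := 2) even_two
  exact this

theorem exists_riskMultikernel_sub_le (hσ : IsTransitionRiskMapping σ)
    (hP : ∀ i, P i ∈ stdSimplex ℝ (Fin n)) (i : Fin n) (v w : Fin n → ℝ) :
    ∃ μ ∈ riskMultikernel σ i (P i), riskOp σ P v i - riskOp σ P w i ≤ μ ⬝ᵥ (v - w) := by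
  obtain ⟨μ, hμ, h1, h2⟩ := (hσ i (P i) (hP i)).exists_dual v
  refine ⟨μ, ⟨hμ, h1⟩, ?_⟩
  rw [dotProduct_sub, h2]
  exact sub_le_sub_left (h1 w) _

/-- A dual vector bounds the difference on one side only, so the maximizer at `v` or the one at `w`
is used, according to the sign. Jensen's inequality and the domination of dual weights by `(1 + ϰ) P
i j` do the rest. -/
theorem sq_riskOp_sub_le (hσ : IsTransitionRiskMapping σ)
    (hP : ∀ i, P i ∈ stdSimplex ℝ (Fin n))
    (hac : ∀ i, ∀ μ ∈ riskMultikernel σ i (P i), ∀ j, P i j = 0 → μ j = 0)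
    (i : Fin n) (v w : Fin n → ℝ) :
    (riskOp σ P v i - riskOp σ P w i) ^ 2
      ≤ (1 + distortion σ P) * ∑ j, P i j * (v j - w j) ^ 2 := by
  have key : ∀ μ ∈ riskMultikernel σ i (P i), ∀ x : Fin n → ℝ,
      (μ ⬝ᵥ x) ^ 2 ≤ (1 + distortion σ P) * ∑ j, P i j * x j ^ 2 := by
    intro μ hμ x
    refine (sq_dotProduct_le_of_mem_stdSimplex hμ.1 x).trans ?_
    rw [Finset.mul_sum]
    refine Finset.sum_le_sum fun j _ => ?_
    rw [← mul_assoc]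
    exact mul_le_mul_of_nonneg_right (le_one_add_distortion_mul hP hac hμ j) (sq_nonneg _)
  obtain ⟨μ, hμ, h1⟩ := exists_riskMultikernel_sub_le hσ hP i v w
  obtain ⟨ν, hν, h2⟩ := exists_riskMultikernel_sub_le hσ hP i w v
  rcases le_total (riskOp σ P w i) (riskOp σ P v i) with h | h
  · exact (pow_le_pow_left₀ (sub_nonneg.2 h) h1 2).trans (key μ hμ (v - w))
  · rw [← neg_sq, neg_sub]
    refine (pow_le_pow_left₀ (sub_nonneg.2 h) h2 2).trans ((key ν hν (w - v)).trans_eq ?_)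
    simp only [Pi.sub_apply, ← neg_sub (v _) (w _), neg_sq]

theorem sum_mul_sq_riskOp_sub_le (hσ : IsTransitionRiskMapping σ)
    (hP : ∀ i, P i ∈ stdSimplex ℝ (Fin n))
    (hac : ∀ i, ∀ μ ∈ riskMultikernel σ i (P i), ∀ j, P i j = 0 → μ j = 0)
    {q : Fin n → ℝ} (hq : q ∈ stdSimplex ℝ (Fin n)) (hqP : q ᵥ* P = q) (v w : Fin n → ℝ) :
    ∑ i, q i * (riskOp σ P v i - riskOp σ P w i) ^ 2
      ≤ (1 + distortion σ P) * ∑ j, q j * (v j - w j) ^ 2 := by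
  calc ∑ i, q i * (riskOp σ P v i - riskOp σ P w i) ^ 2
      ≤ ∑ i, q i * ((1 + distortion σ P) * ∑ j, P i j * (v j - w j) ^ 2) :=
        Finset.sum_le_sum fun i _ =>
          mul_le_mul_of_nonneg_left (sq_riskOp_sub_le hσ hP hac i v w) (hq.1 i)
    _ = (1 + distortion σ P) * ∑ i, ∑ j, q i * P i j * (v j - w j) ^ 2 := by
        rw [Finset.mul_sum]
        refine Finset.sum_congr rfl fun i _ => ?_
        rw [mul_left_comm, Finset.mul_sum]
        simp only [mul_assoc]
    _ = (1 + distortion σ P) * ∑ j, q j * (v j - w j) ^ 2 := by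
        rw [Finset.sum_comm]
        congr 1
        refine Finset.sum_congr rfl fun j _ => ?_
        rw [← Finset.sum_mul]
        congr 1
        exact congrFun hqP j

end Contraction

/-! ### Existence, uniqueness and the monotone drift at the projected solution. -/

section WeightedSpace

variable {n : ℕ}

/-- The scaling which turns the norm `‖·‖_q` into the Euclidean norm. -/
noncomputable def weightedEquiv {q : Fin n → ℝ} (hq : ∀ i, 0 < q i) :
    (Fin n → ℝ) ≃ₗ[ℝ] EuclideanSpace ℝ (Fin n) :=
  (LinearEquiv.piCongrRight fun i =>
    LinearEquiv.smulOfNeZero ℝ ℝ (√(q i)) (Real.sqrt_pos.2 (hq i)).ne').trans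
    (WithLp.linearEquiv 2 ℝ (Fin n → ℝ)).symm

variable {q : Fin n → ℝ} (hq : ∀ i, 0 < q i)

@[simp] theorem weightedEquiv_apply (v : Fin n → ℝ) (i : Fin n) :
    weightedEquiv hq v i = √(q i) * v i := rfl

theorem inner_weightedEquiv (v w : Fin n → ℝ) :
    inner ℝ (weightedEquiv hq v) (weightedEquiv hq w) = ∑ i, q i * (v i * w i) := by
  rw [PiLp.inner_apply]
  refine Finset.sum_congr rfl fun i _ => ?_
  simp only [weightedEquiv_apply, RCLike.inner_apply, conj_trivial]
  rw [mul_mul_mul_comm, Real.mul_self_sqrt (hq i).le, mul_comm (w i)]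

theorem norm_weightedEquiv (v : Fin n → ℝ) : ‖weightedEquiv hq v‖ = qNorm q v := by
  rw [@norm_eq_sqrt_real_inner, inner_weightedEquiv]
  simp only [qNorm, pow_two]

variable {m : ℕ} {σ : Fin n → (Fin n → ℝ) → (Fin n → ℝ) → ℝ} {P : Matrix (Fin n) (Fin n) ℝ}
  {c : Fin n → ℝ} {α : ℝ} {Φ : Matrix (Fin n) (Fin m) ℝ}

/-- The range of `Φ`, in the Euclidean coordinates for `‖·‖_q`. -/
noncomputable def weightedRange (Φ : Matrix (Fin n) (Fin m) ℝ) :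
    Submodule ℝ (EuclideanSpace ℝ (Fin n)) :=
  LinearMap.range ((weightedEquiv hq).toLinearMap ∘ₗ Φ.mulVecLin)

/-- Transfers the problem to a genuine inner product space, where the projection lemmas apply. -/
theorem isProjectedSolution_iff {v : Fin n → ℝ} :
    IsProjectedSolution σ P q c α Φ v ↔
      IsArgmin (fun z => ‖z - weightedEquiv hq (c + α • riskOp σ P v)‖)
        (weightedRange hq Φ : Set (EuclideanSpace ℝ (Fin n))) (weightedEquiv hq v) := by
  have hmem : ∀ w, weightedEquiv hq w ∈ (weightedRange hq Φ : Set (EuclideanSpace ℝ (Fin n))) ↔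
      w ∈ Set.range fun r : Fin m → ℝ => Φ *ᵥ r := by
    intro w
    simp only [weightedRange, SetLike.mem_coe, LinearMap.mem_range, LinearMap.comp_apply,
      LinearEquiv.coe_coe, EmbeddingLike.apply_eq_iff_eq, Matrix.mulVecLin_apply, Set.mem_range]
  have hnorm : ∀ z u, ‖weightedEquiv hq z - weightedEquiv hq u‖ = qNorm q (z - u) := by
    intro z u
    rw [← map_sub, norm_weightedEquiv]
  refine and_congr (hmem v).symm ⟨fun h z hz => ?_, fun h z hz => ?_⟩
  · obtain ⟨w, rfl⟩ := (weightedEquiv hq).surjective z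
    simpa only [hnorm] using h w ((hmem w).1 hz)
  · simpa only [hnorm] using h _ ((hmem z).2 hz)

theorem IsProjectedSolution.mem_range {v : Fin n → ℝ}
    (h : IsProjectedSolution σ P q c α Φ v) : ∃ s, Φ *ᵥ s = v :=
  h.1

include hq in
/-- The residual of a solution is orthogonal to the range of `Φ`. -/
theorem IsProjectedSolution.sum_mul_eq_zero {v : Fin n → ℝ}
    (h : IsProjectedSolution σ P q c α Φ v) (s : Fin m → ℝ) :
    ∑ i, q i * ((c i + α * riskOp σ P v i - v i) * (Φ *ᵥ s) i) = 0 := by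
  have h' := (isProjectedSolution_iff hq).1 h
  have hs : weightedEquiv hq (Φ *ᵥ s) ∈ weightedRange hq Φ := ⟨s, rfl⟩
  have key : ∀ z ∈ weightedRange hq Φ, inner ℝ
      (weightedEquiv hq (c + α • riskOp σ P v) - weightedEquiv hq v) z ≤ 0 := by
    intro z hz
    have := h'.inner_le_zero (weightedRange hq Φ).convex
      -- On a subspace the variational inequality may be tested in any direction `z`; using `z` and
      -- `-z` turns it into orthogonality.
      (w := weightedEquiv hq v + z) ((weightedRange hq Φ).add_mem h'.1 hz)
    rwa [add_sub_cancel_left] at this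
  have h1 := key _ hs
  have h2 := key _ ((weightedRange hq Φ).neg_mem hs)
  rw [inner_neg_right] at h2
  rw [← map_sub, inner_weightedEquiv] at h1 h2
  simp only [Pi.sub_apply, Pi.add_apply, Pi.smul_apply, smul_eq_mul] at h1 h2
  linarith

include hq in
theorem existsUnique_isProjectedSolution (hσ : IsTransitionRiskMapping σ)
    (hP : ∀ i, P i ∈ stdSimplex ℝ (Fin n))
    (hac : ∀ i, ∀ μ ∈ riskMultikernel σ i (P i), ∀ j, P i j = 0 → μ j = 0)
    (hqs : q ∈ stdSimplex ℝ (Fin n)) (hqP : q ᵥ* P = q) (hα₀ : 0 < α)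
    (hcontr : α * √(1 + distortion σ P) < 1) :
    ∃ v, IsProjectedSolution σ P q c α Φ v ∧
      ∀ w, IsProjectedSolution σ P q c α Φ w → w = v := by
  let S := weightedEquiv hq
  let K : Submodule ℝ (EuclideanSpace ℝ (Fin n)) := weightedRange hq Φ
  have hconv : Convex ℝ (K : Set (EuclideanSpace ℝ (Fin n))) := K.convex
  choose pr hpr using exists_isArgmin_norm_sub (Y := (K : Set (EuclideanSpace ℝ (Fin n))))
    ⟨0, K.zero_mem⟩ K.closed_of_finiteDimensional hconv
  -- The Banach fixed point map in Euclidean coordinates.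
  let T : EuclideanSpace ℝ (Fin n) → EuclideanSpace ℝ (Fin n) := fun x =>
    pr (S (c + α • riskOp σ P (S.symm x)))
  have hrisk : ∀ v w, ‖S (riskOp σ P v - riskOp σ P w)‖
      ≤ √(1 + distortion σ P) * ‖S (v - w)‖ := by
    intro v w
    rw [norm_weightedEquiv, norm_weightedEquiv, qNorm, qNorm,
      ← Real.sqrt_mul (by linarith [distortion_nonneg (σ := σ) (P := P)])]
    exact Real.sqrt_le_sqrt (sum_mul_sq_riskOp_sub_le hσ hP hac hqs hqP v w)
  have hT : ContractingWith (α * √(1 + distortion σ P)).toNNReal T := by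
    refine ⟨by simpa using hcontr, LipschitzWith.of_dist_le_mul fun x y => ?_⟩
    rw [Real.coe_toNNReal _ (by positivity), dist_eq_norm, dist_eq_norm]
    have h1 : ‖T x - T y‖ ≤ _ := (hpr _).norm_sub_le hconv (hpr _)
    have h2 := hrisk (S.symm x) (S.symm y)
    rw [map_sub S (S.symm x), S.apply_symm_apply, S.apply_symm_apply] at h2
    rw [← map_sub, add_sub_add_left_eq_sub, ← smul_sub, map_smul, norm_smul,
      Real.norm_of_nonneg hα₀.le] at h1
    rw [mul_assoc]
    exact h1.trans (mul_le_mul_of_nonneg_left h2 hα₀.le)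
  have hiff : ∀ v, IsProjectedSolution σ P q c α Φ v ↔ T (S v) = S v := by
    intro v
    have hTv : T (S v) = pr (S (c + α • riskOp σ P v)) := by
      simp only [T, S.symm_apply_apply]
    rw [isProjectedSolution_iff hq, hTv]
    constructor
    · intro h
      have := (hpr (S (c + α • riskOp σ P v))).norm_sub_le hconv h
      rw [sub_self, norm_zero] at this
      exact sub_eq_zero.1 (norm_le_zero_iff.1 this)
    · intro h
      have := hpr (S (c + α • riskOp σ P v))
      rwa [h] at this
  refine ⟨S.symm (ContractingWith.fixedPoint T hT), ?_, fun w hw => ?_⟩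
  · rw [hiff, S.apply_symm_apply]
    exact hT.fixedPoint_isFixedPt
  · rw [LinearEquiv.eq_symm_apply]
    exact hT.fixedPoint_unique ((hiff w).1 hw)

include hq in
/-- The mean drift is strictly monotone at the solution. -/
theorem IsProjectedSolution.drift_ge {v : Fin n → ℝ}
    (h : IsProjectedSolution σ P q c α Φ v) (hσ : IsTransitionRiskMapping σ)
    (hP : ∀ i, P i ∈ stdSimplex ℝ (Fin n))
    (hac : ∀ i, ∀ μ ∈ riskMultikernel σ i (P i), ∀ j, P i j = 0 → μ j = 0)
    (hqs : q ∈ stdSimplex ℝ (Fin n)) (hqP : q ᵥ* P = q) (hα₀ : 0 < α) (s : Fin m → ℝ) :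
    (1 - α * √(1 + distortion σ P)) * ∑ i, q i * ((Φ *ᵥ s) i - v i) ^ 2
      ≤ ∑ i, q i * (((Φ *ᵥ s) i - c i - α * riskOp σ P (Φ *ᵥ s) i) * ((Φ *ᵥ s) i - v i)) := by
  obtain ⟨s₀, hs₀⟩ := h.mem_range
  have h0 := h.sum_mul_eq_zero hq (s - s₀)
  rw [Matrix.mulVec_sub, hs₀] at h0
  set y := Φ *ᵥ s
  set κ := √(1 + distortion σ P)
  set A := ∑ i, q i * (y i - v i) ^ 2 with hA
  have hA0 : 0 ≤ A := Finset.sum_nonneg fun i _ => mul_nonneg (hq i).le (sq_nonneg _)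
  have hB := sum_mul_sq_riskOp_sub_le hσ hP hac hqs hqP y v
  have hκ : κ ^ 2 = 1 + distortion σ P :=
    Real.sq_sqrt (by linarith [distortion_nonneg (σ := σ) (P := P)])
  have hκ1 : 1 ≤ κ := Real.one_le_sqrt.2 (by linarith [distortion_nonneg (σ := σ) (P := P)])
  rw [← hκ, ← hA] at hB
  -- Cauchy–Schwarz in the form `2κab ≤ a² + κ²b²`; dividing by `κ ≥ 1` at the end avoids square
  -- roots of sums.
  have hsum : ∑ i, q i * ((riskOp σ P y i - riskOp σ P v i) * (y i - v i)) ≤ κ * A := by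
    have h1 : ∑ i, 2 * κ * (q i * ((riskOp σ P y i - riskOp σ P v i) * (y i - v i)))
        ≤ ∑ i, (q i * (riskOp σ P y i - riskOp σ P v i) ^ 2
          + κ ^ 2 * (q i * (y i - v i) ^ 2)) := by
      refine Finset.sum_le_sum fun i _ => ?_
      nlinarith [mul_nonneg (hq i).le
        (sq_nonneg ((riskOp σ P y i - riskOp σ P v i) - κ * (y i - v i)))]
    rw [Finset.sum_add_distrib, ← Finset.mul_sum, ← Finset.mul_sum, ← hA] at h1
    have h2 : κ * ∑ i, q i * ((riskOp σ P y i - riskOp σ P v i) * (y i - v i)) ≤ κ * (κ * A) := by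
      linarith
    exact le_of_mul_le_mul_left h2 (by linarith)
  -- The last sum vanishes because `y - v` lies in the range of `Φ`.
  have hsplit : ∑ i, q i * ((y i - c i - α * riskOp σ P y i) * (y i - v i))
      = A - α * ∑ i, q i * ((riskOp σ P y i - riskOp σ P v i) * (y i - v i))
        - ∑ i, q i * ((c i + α * riskOp σ P v i - v i) * (y - v) i) := by
    rw [hA, Finset.mul_sum, ← Finset.sum_sub_distrib, ← Finset.sum_sub_distrib]
    refine Finset.sum_congr rfl fun i _ => ?_
    rw [Pi.sub_apply]
    ring
  rw [hsplit, h0]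
  nlinarith

end WeightedSpace

/-! ### The Poisson equation of an irreducible chain. -/

section Poisson

variable {n : ℕ} {P : Matrix (Fin n) (Fin n) ℝ}

theorem pow_mulVec_eq_self {x : Fin n → ℝ} (h : P *ᵥ x = x) (k : ℕ) : (P ^ k) *ᵥ x = x := by
  induction k with
  | zero => simp
  | succ k ih => rw [pow_succ, ← Matrix.mulVec_mulVec, h, ih]

theorem vecMul_pow_eq_self {q : Fin n → ℝ} (h : q ᵥ* P = q) (k : ℕ) : q ᵥ* (P ^ k) = q := by
  induction k with
  | zero => simp
  | succ k ih => rw [pow_succ, ← Matrix.vecMul_vecMul, ih, h]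

theorem mulVec_one_of_mem_stdSimplex (hP : ∀ i, P i ∈ stdSimplex ℝ (Fin n)) : P *ᵥ 1 = 1 := by
  ext i
  simpa [Matrix.mulVec, dotProduct] using (hP i).2

theorem stationary_pos (hP : ∀ i, P i ∈ stdSimplex ℝ (Fin n)) (hirr : P.IsIrreducible)
    {q : Fin n → ℝ} (hq : q ∈ stdSimplex ℝ (Fin n)) (hqP : q ᵥ* P = q) (j : Fin n) : 0 < q j := by
  obtain ⟨i, hi⟩ : ∃ i, 0 < q i := by
    by_contra! h
    have : ∑ i, q i ≤ 0 := Finset.sum_nonpos fun i _ => h i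
    rw [hq.2] at this
    linarith
  obtain ⟨k, -, hk⟩ := (Matrix.isIrreducible_iff_exists_pow_pos fun i j => (hP i).1 j).1 hirr i j
  have h1 : ∑ l, q l * (P ^ k) l j = q j := congrFun (vecMul_pow_eq_self hqP k) j
  rw [← h1]
  refine Finset.sum_pos' (fun l _ => mul_nonneg (hq.1 l)
    (Matrix.pow_apply_nonneg (fun i j => (hP i).1 j) k l j)) ⟨i, Finset.mem_univ i, mul_pos hi hk⟩

/-- Harmonic functions of an irreducible chain are constant. -/
theorem eq_of_mulVec_eq_self (hP : ∀ i, P i ∈ stdSimplex ℝ (Fin n)) (hirr : P.IsIrreducible)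
    {x : Fin n → ℝ} (hx : P *ᵥ x = x) (i j : Fin n) : x i = x j := by
  have : Nonempty (Fin n) := ⟨i⟩
  -- Maximum principle: `x a` is an average of the values of `x` under each power of `P`, and some
  -- power gives positive weight to any prescribed state.
  obtain ⟨a, ha⟩ := Finite.exists_max x
  suffices h : ∀ b, x b = x a by rw [h i, h j]
  intro b
  obtain ⟨k, -, hk⟩ := (Matrix.isIrreducible_iff_exists_pow_pos fun i j => (hP i).1 j).1 hirr a b
  have hnn := Matrix.pow_apply_nonneg (fun i j => (hP i).1 j) k a
  have h1 : ∑ l, (P ^ k) a l * x l = x a := congrFun (pow_mulVec_eq_self hx k) a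
  have h2 : ∑ l, (P ^ k) a l * (1 : Fin n → ℝ) l = 1 :=
    congrFun (pow_mulVec_eq_self (mulVec_one_of_mem_stdSimplex hP) k) a
  have h3 : ∑ l, (P ^ k) a l * (x a - x l) = 0 := by
    have e : ∀ l, (P ^ k) a l * (x a - x l)
        = (P ^ k) a l * (1 : Fin n → ℝ) l * x a - (P ^ k) a l * x l := fun l => by
      rw [Pi.one_apply]; ring
    simp only [e]
    rw [Finset.sum_sub_distrib, ← Finset.sum_mul, h1, h2, one_mul, sub_self]
  have h4 := (Finset.sum_eq_zero_iff_of_nonneg fun l _ =>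
    mul_nonneg (hnn l) (sub_nonneg.2 (ha l))).1 h3 b (Finset.mem_univ b)
  rcases mul_eq_zero.1 h4 with h | h
  · exact absurd h hk.ne'
  · linarith

/-- The Poisson equation of an irreducible chain has a solution depending linearly on the
right hand side. -/
theorem exists_poisson (hP : ∀ i, P i ∈ stdSimplex ℝ (Fin n)) (hirr : P.IsIrreducible)
    {q : Fin n → ℝ} (hq : q ∈ stdSimplex ℝ (Fin n)) (hqP : q ᵥ* P = q) :
    ∃ Z : Matrix (Fin n) (Fin n) ℝ, ∀ (h : Fin n → ℝ) (i : Fin n),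
      h i - q ⬝ᵥ h = (Z *ᵥ h) i - ∑ j, P i j * (Z *ᵥ h) j := by
  -- The rank-one term removes the constants from the kernel of `1 - P`. As `q M = q`, a kernel
  -- vector has mean zero and is then harmonic, hence constant, hence zero; `Z` is the inverse of
  -- `M`.
  let M : Matrix (Fin n) (Fin n) ℝ := 1 - P + Matrix.vecMulVec 1 q
  have hM : ∀ x i, (M *ᵥ x) i = x i - (P *ᵥ x) i + q ⬝ᵥ x := by
    intro x i
    simp [M, Matrix.add_mulVec, Matrix.sub_mulVec]
    rfl
  have hqM : ∀ x, q ⬝ᵥ (M *ᵥ x) = q ⬝ᵥ x := by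
    intro x
    have e : M *ᵥ x = x - P *ᵥ x + (q ⬝ᵥ x) • (1 : Fin n → ℝ) := by
      ext i; rw [hM]; simp
    have h1 : q ⬝ᵥ (1 : Fin n → ℝ) = 1 := by simpa [dotProduct] using hq.2
    rw [e, dotProduct_add, dotProduct_sub, Matrix.dotProduct_mulVec, hqP, dotProduct_smul, h1]
    simp
  have hinj : Function.Injective M.mulVec := by
    have hker : ∀ x, M *ᵥ x = 0 → x = 0 := by
      intro x hx
      have h0 : q ⬝ᵥ x = 0 := by rw [← hqM, hx, dotProduct_zero]
      have hPx : P *ᵥ x = x := by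
        ext i
        have := hM x i
        rw [hx, h0, Pi.zero_apply] at this
        linarith
      ext i
      have hc : x = fun _ => x i := funext fun j => eq_of_mulVec_eq_self hP hirr hPx j i
      rw [hc] at h0
      simpa [dotProduct, ← Finset.sum_mul, hq.2] using h0
    intro x y hxy
    refine sub_eq_zero.1 (hker _ ?_)
    rw [Matrix.mulVec_sub, sub_eq_zero]
    exact hxy
  have hu : IsUnit M := Matrix.mulVec_injective_iff_isUnit.1 hinj
  refine ⟨M⁻¹, fun h i => ?_⟩
  have h1 : M *ᵥ (M⁻¹ *ᵥ h) = h := by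
    rw [Matrix.mulVec_mulVec, Matrix.mul_nonsing_inv _ ((Matrix.isUnit_iff_isUnit_det M).1 hu),
      Matrix.one_mulVec]
  have h2 := hM (M⁻¹ *ᵥ h) i
  have h3 := hqM (M⁻¹ *ᵥ h)
  rw [h1] at h2 h3
  rw [h2, ← h3]
  simp [Matrix.mulVec, dotProduct]

end Poisson

/-! ### Deterministic analysis of perturbed descent recursions. -/

section SmallOnWindows

/-- The partial sums of `e` are small relative to those of `γ`, uniformly far away. -/
def SmallOnWindows (γ e : ℕ → ℝ) : Prop :=
  ∀ ε > 0, ∃ N, ∀ s ≥ N, ∀ t ≥ s,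
    ∑ u ∈ Finset.Ico s t, e u ≤ ε * (1 + 2 * ∑ u ∈ Finset.Ico s t, γ u)

variable {γ e f : ℕ → ℝ}

theorem SmallOnWindows.add (he : SmallOnWindows γ e) (hf : SmallOnWindows γ f) :
    SmallOnWindows γ (fun t => e t + f t) := by
  intro ε hε
  obtain ⟨N, hN⟩ := he (ε / 2) (by linarith)
  obtain ⟨M, hM⟩ := hf (ε / 2) (by linarith)
  refine ⟨max N M, fun s hs t ht => ?_⟩
  rw [Finset.sum_add_distrib]
  have h1 := hN s ((le_max_left _ _).trans hs) t ht
  have h2 := hM s ((le_max_right _ _).trans hs) t ht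
  linarith

theorem SmallOnWindows.const_mul (he : SmallOnWindows γ e) {C : ℝ} (hC : 0 < C) :
    SmallOnWindows γ (fun t => C * e t) := by
  intro ε hε
  obtain ⟨N, hN⟩ := he (ε / C) (by positivity)
  refine ⟨N, fun s hs t ht => ?_⟩
  have h1 := hN s hs t ht
  rw [div_mul_eq_mul_div, le_div_iff₀ hC] at h1
  rwa [← Finset.mul_sum, mul_comm]

theorem SmallOnWindows.mono (he : SmallOnWindows γ e) {N₀ : ℕ} (h : ∀ t ≥ N₀, f t ≤ e t) :
    SmallOnWindows γ f := by
  intro ε hε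
  obtain ⟨N, hN⟩ := he ε hε
  refine ⟨max N N₀, fun s hs t ht => le_trans (Finset.sum_le_sum fun u hu => h u ?_)
    (hN s ((le_max_left _ _).trans hs) t ht)⟩
  exact ((le_max_right _ _).trans hs).trans (Finset.mem_Ico.1 hu).1

theorem SmallOnWindows.of_tendsto (hγ : ∀ t, 0 < γ t) {l : ℝ}
    (h : Tendsto (fun t => ∑ u ∈ Finset.range t, e u) atTop (𝓝 l)) : SmallOnWindows γ e := by
  intro ε hε
  obtain ⟨N, hN⟩ := Metric.cauchySeq_iff.1 h.cauchySeq ε hε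
  refine ⟨N, fun s hs t ht => ?_⟩
  have h1 := hN t (hs.trans ht) s hs
  rw [Real.dist_eq, ← Finset.sum_Ico_eq_sub _ ht] at h1
  have h2 : 0 ≤ ∑ u ∈ Finset.Ico s t, γ u := Finset.sum_nonneg fun u _ => (hγ u).le
  nlinarith [le_abs_self (∑ u ∈ Finset.Ico s t, e u), mul_nonneg hε.le h2]

theorem SmallOnWindows.of_telescope (hγ : ∀ t, 0 < γ t) {u : ℕ → ℝ}
    (hu : Tendsto u atTop (𝓝 0)) : SmallOnWindows γ (fun t => u t - u (t + 1)) := by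
  refine .of_tendsto hγ (l := u 0 - 0) ?_
  simp only [Finset.sum_range_sub']
  exact tendsto_const_nhds.sub hu

/-- A long window is cut into pieces whose step sizes sum to between `1/2` and `1`. Each complete
piece costs `ε` and is paid for by `2ε` times its step sum; the leftover piece accounts for the
constant `1`. -/
theorem SmallOnWindows.of_unit_windows (hγ : ∀ t, 0 < γ t) (hγ0 : Tendsto γ atTop (𝓝 0))
    (h : ∀ ε > 0, ∃ N, ∀ s ≥ N, ∀ t ≥ s, ∑ u ∈ Finset.Ico s t, γ u ≤ 1 →
      ∑ u ∈ Finset.Ico s t, e u ≤ ε) : SmallOnWindows γ e := by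
  intro ε hε
  obtain ⟨N, hN⟩ := h ε hε
  -- Steps of at most `1/2` ensure that the first sum exceeding `1/2` does not exceed `1`.
  obtain ⟨M, hM⟩ := eventually_atTop.1 (hγ0.eventually_le_const (u := 1 / 2) (by norm_num))
  refine ⟨max N M, ?_⟩
  suffices H : ∀ k s, s ≥ max N M → ∑ u ∈ Finset.Ico s (s + k), e u
      ≤ ε * (1 + 2 * ∑ u ∈ Finset.Ico s (s + k), γ u) by
    intro s hs t ht
    obtain ⟨k, rfl⟩ := Nat.exists_eq_add_of_le ht
    exact H k s hs
  intro k
  induction k using Nat.strong_induction_on with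
  | _ k ih =>
    intro s hs
    have hsN := (le_max_left _ _).trans hs
    have hsM := (le_max_right _ _).trans hs
    by_cases hk : ∑ u ∈ Finset.Ico s (s + k), γ u ≤ 1
    · have h1 := hN s hsN (s + k) (by lia) hk
      have h2 : 0 ≤ ∑ u ∈ Finset.Ico s (s + k), γ u := Finset.sum_nonneg fun u _ => (hγ u).le
      nlinarith [mul_nonneg hε.le h2]
    · have hex : ∃ l, 1 / 2 < ∑ u ∈ Finset.Ico s (s + l), γ u := ⟨k, by linarith⟩
      classical
      obtain ⟨l, hl1, hl2⟩ : ∃ l, 1 / 2 < ∑ u ∈ Finset.Ico s (s + l), γ u ∧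
          ∀ l' < l, ∑ u ∈ Finset.Ico s (s + l'), γ u ≤ 1 / 2 :=
        ⟨Nat.find hex, Nat.find_spec hex, fun l' h' => not_lt.1 (Nat.find_min hex h')⟩
      obtain ⟨l, rfl⟩ : ∃ l', l = l' + 1 := by
        rcases l with _ | l
        · norm_num at hl1
        · exact ⟨l, rfl⟩
      have h3 := hl2 l (by lia)
      have h4 : ∑ u ∈ Finset.Ico s (s + (l + 1)), γ u ≤ 1 := by
        rw [← add_assoc, Finset.sum_Ico_succ_top (by lia)]
        linarith [hM (s + l) (by lia)]
      have hlk : l + 1 ≤ k := by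
        by_contra! hlt
        exact hk ((hl2 k hlt).trans (by norm_num))
      have h5 := hN s hsN (s + (l + 1)) (by lia) h4
      have h6 := ih (k - (l + 1)) (by lia) (s + (l + 1)) (by lia)
      have hsk : s + (l + 1) + (k - (l + 1)) = s + k := by lia
      rw [hsk] at h6
      rw [← Finset.sum_Ico_consecutive e (show s ≤ s + (l + 1) by lia)
          (show s + (l + 1) ≤ s + k by lia),
        ← Finset.sum_Ico_consecutive γ (show s ≤ s + (l + 1) by lia)
          (show s + (l + 1) ≤ s + k by lia)]
      nlinarith

/-- A nonnegative sequence with a drift towards zero and errors small on windows tends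
to zero. -/
theorem tendsto_zero_of_drift {V H : ℕ → ℝ} (hγ : ∀ t, 0 < γ t) (hγ0 : Tendsto γ atTop (𝓝 0))
    (hγs : Tendsto (fun T => ∑ t ∈ Finset.range T, γ t) atTop atTop)
    (he : SmallOnWindows γ e) (hV : ∀ t, 0 ≤ V t) (hH : ∀ t, 0 ≤ H t)
    (hHV : ∀ η > 0, ∃ δ > 0, ∃ N, ∀ t ≥ N, η ≤ V t → δ ≤ H t)
    {N₀ : ℕ} (hrec : ∀ t ≥ N₀, V (t + 1) ≤ V t - γ t * H t + e t) : Tendsto V atTop (𝓝 0) := by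
  have hsum : ∀ s ≥ N₀, ∀ k, V (s + k) ≤ V s - ∑ u ∈ Finset.Ico s (s + k), γ u * H u
      + ∑ u ∈ Finset.Ico s (s + k), e u := by
    intro s hs k
    induction k with
    | zero => simp
    | succ k ih =>
      rw [← add_assoc, Finset.sum_Ico_succ_top (by lia), Finset.sum_Ico_succ_top (by lia)]
      linarith [hrec (s + k) (by lia)]
  rw [Metric.tendsto_atTop]
  intro η hη
  obtain ⟨δ, hδ, N₁, hN₁⟩ := hHV (η / 4) (by linarith)
  -- With this choice the window error is at most `η/4` plus half of the descent `δ ∑ γ`.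
  set ε := min (δ / 4) (η / 4) with hεdef
  have hε : 0 < ε := lt_min (by linarith) (by linarith)
  obtain ⟨N₂, hN₂⟩ := he ε hε
  obtain ⟨N₃, hN₃⟩ := eventually_atTop.1
    (hγ0.eventually_le_const (u := η / 4 / δ) (by positivity))
  set N := max (max N₀ N₁) (max N₂ N₃) with hN
  -- The starting time is exempt from the lower bound on `V`, so that a run may begin just below the
  -- level `η/4`; the missing descent `δ γ_s` costs another `η/4`.
  have hrun : ∀ s ≥ N, ∀ k, (∀ u, s < u → u < s + k → η / 4 ≤ V u) →
      V (s + k) ≤ V s - δ / 2 * ∑ u ∈ Finset.Ico s (s + k), γ u + η / 2 := by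
    intro s hs k hu
    have h1 := hsum s (by lia) k
    have h2 := hN₂ s (by lia) (s + k) (by lia)
    have h3 := hN₃ s (by lia)
    rw [le_div_iff₀ hδ] at h3
    have h0 : 0 ≤ ∑ u ∈ Finset.Ico s (s + k), γ u := Finset.sum_nonneg fun u _ => (hγ u).le
    have h4 : δ * ∑ u ∈ Finset.Ico s (s + k), γ u - δ * γ s
        ≤ ∑ u ∈ Finset.Ico s (s + k), γ u * H u := by
      rcases k with _ | k
      · simp [(mul_pos hδ (hγ s)).le]
      · rw [Finset.sum_eq_sum_Ico_succ_bot (by lia) γ,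
          Finset.sum_eq_sum_Ico_succ_bot (by lia) fun u => γ u * H u]
        have h5 : δ * ∑ u ∈ Finset.Ico (s + 1) (s + (k + 1)), γ u
            ≤ ∑ u ∈ Finset.Ico (s + 1) (s + (k + 1)), γ u * H u := by
          rw [Finset.mul_sum]
          refine Finset.sum_le_sum fun u hu' => ?_
          rw [Finset.mem_Ico] at hu'
          rw [mul_comm]
          exact mul_le_mul_of_nonneg_left (hN₁ u (by lia) (hu u (by lia) (by lia))) (hγ u).le
        linarith [mul_nonneg (hγ s).le (hH s)]
    have h6 : ε * ∑ u ∈ Finset.Ico s (s + k), γ u ≤ δ / 4 * ∑ u ∈ Finset.Ico s (s + k), γ u :=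
      mul_le_mul_of_nonneg_right (min_le_left _ _) h0
    have h7 : ε ≤ η / 4 := min_le_right _ _
    linarith
  -- Otherwise the divergence of `∑ γ` would drive `V` below zero.
  obtain ⟨s₀, hs₀, hVs₀⟩ : ∃ s ≥ N, V s < η / 4 := by
    by_contra! hno
    obtain ⟨T, hT⟩ := eventually_atTop.1 (hγs.eventually_gt_atTop
      (∑ t ∈ Finset.range N, γ t + (V N + η / 2) * 2 / δ))
    have h1 := hrun N le_rfl T fun u hu _ => hno u hu.le
    have h2 := hT (N + T) (by lia)
    have h3 : ∑ u ∈ Finset.Ico N (N + T), γ u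
        = ∑ u ∈ Finset.range (N + T), γ u - ∑ u ∈ Finset.range N, γ u :=
      Finset.sum_Ico_eq_sub _ (by lia)
    have h4 : (V N + η / 2) * 2 / δ < ∑ u ∈ Finset.Ico N (N + T), γ u := by linarith
    rw [div_lt_iff₀ hδ] at h4
    linarith [hV (N + T)]
  refine ⟨s₀, fun t ht => ?_⟩
  rw [Real.dist_eq, sub_zero, abs_of_nonneg (hV t)]
  classical
  let p : ℕ → Prop := fun s => s₀ ≤ s ∧ V s < η / 4
  -- From the last visit below `η/4` up to time `t`, `V` gains at most `η/2`, hence stays below `η`.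
  set s := Nat.findGreatest p t with hs
  have hps : p s := Nat.findGreatest_spec ht (show p s₀ from ⟨le_rfl, hVs₀⟩)
  have hst : s ≤ t := Nat.findGreatest_le t
  obtain ⟨k, hk⟩ := Nat.exists_eq_add_of_le hst
  have h1 := hrun s (hs₀.trans hps.1) k fun u hu hu' => by
    by_contra! hlt
    exact Nat.findGreatest_is_greatest (P := p) hu (by lia) ⟨hps.1.trans hu.le, hlt⟩
  have h0 : 0 ≤ ∑ u ∈ Finset.Ico s (s + k), γ u := Finset.sum_nonneg fun u _ => (hγ u).le
  rw [← hk] at h1 h0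
  nlinarith [hps.2, mul_nonneg hδ.le h0]

end SmallOnWindows

/-! ### Almost sure convergence of random series. -/

section Martingale

variable {Ω : Type*} {m0 : MeasurableSpace Ω} {μ : Measure Ω} [IsProbabilityMeasure μ]

/-- A series of square integrable martingale differences with summable variances converges. -/
theorem ae_exists_tendsto_sum_of_condExp_eq_zero (F : Filtration ℕ m0) {D : ℕ → Ω → ℝ}
    (hD : ∀ t, StronglyMeasurable[F (t + 1)] (D t)) (hL : ∀ t, MemLp (D t) 2 μ)
    (h0 : ∀ t, μ[D t | F t] =ᵐ[μ] 0) {R : ℝ}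
    (hR : ∀ T, ∑ t ∈ Finset.range T, ∫ ω, D t ω ^ 2 ∂μ ≤ R) :
    ∀ᵐ ω ∂μ, ∃ l, Tendsto (fun T => ∑ t ∈ Finset.range T, D t ω) atTop (𝓝 l) := by
  let M : ℕ → Ω → ℝ := fun T ω => ∑ t ∈ Finset.range T, D t ω
  have hMs : ∀ T, M (T + 1) = M T + D T := fun T => by
    ext ω
    exact Finset.sum_range_succ _ _
  have hML : ∀ T, MemLp (M T) 2 μ := fun T => memLp_finsetSum _ fun t _ => hL t
  have hMa : StronglyAdapted F M := fun T =>
    Finset.stronglyMeasurable_fun_sum _ fun t ht => (hD t).mono (F.mono (Finset.mem_range.1 ht))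
  have hM : Martingale M F μ := by
    refine martingale_of_condExp_sub_eq_zero_nat hMa
      (fun T => (hML T).integrable one_le_two) fun T => ?_
    rw [hMs, add_sub_cancel_left]
    exact h0 T
  -- Orthogonality of the increments makes second moments add up; `|x| ≤ 1 + x²` then gives the `L¹`
  -- bound for the submartingale convergence theorem.
  have horth : ∀ T, ∫ ω, M T ω * D T ω ∂μ = 0 := by
    intro T
    have hint : Integrable (M T * D T) μ := (hML T).integrable_mul (hL T)
    have h1 := condExp_mul_of_stronglyMeasurable_left (hMa T) hint
      ((hL T).integrable one_le_two)
    have h2 : μ[M T * D T | F T] =ᵐ[μ] 0 := by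
      filter_upwards [h1, h0 T] with ω h1 h2
      rw [h1, Pi.mul_apply, h2]
      simp
    calc ∫ ω, M T ω * D T ω ∂μ = ∫ ω, (μ[M T * D T | F T]) ω ∂μ :=
          (integral_condExp (F.le T)).symm
      _ = 0 := by rw [integral_congr_ae h2]; simp
  have hvar : ∀ T, ∫ ω, M T ω ^ 2 ∂μ = ∑ t ∈ Finset.range T, ∫ ω, D t ω ^ 2 ∂μ := by
    intro T
    induction T with
    | zero => simp [M]
    | succ T ih =>
      have e : ∀ ω, M (T + 1) ω ^ 2 = M T ω ^ 2 + 2 * (M T ω * D T ω) + D T ω ^ 2 := by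
        intro ω
        rw [hMs, Pi.add_apply]
        ring
      have hint : Integrable (fun ω => M T ω * D T ω) μ := (hML T).integrable_mul (hL T)
      have hint' : Integrable (fun ω => M T ω ^ 2 + 2 * (M T ω * D T ω)) μ :=
        (hML T).integrable_sq.add (hint.const_mul 2)
      simp only [e]
      rw [integral_add hint' (hL T).integrable_sq,
        integral_add (hML T).integrable_sq (hint.const_mul 2), integral_const_mul, horth, ih,
        Finset.sum_range_succ]
      ring
  refine hM.submartingale.exists_ae_tendsto_of_bdd (R := (1 + R).toNNReal) fun T => ?_
  rw [eLpNorm_one_eq_lintegral_enorm,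
    ← ofReal_integral_norm_eq_lintegral_enorm ((hML T).integrable one_le_two)]
  refine ENNReal.ofReal_le_ofReal ?_
  calc ∫ ω, ‖M T ω‖ ∂μ ≤ ∫ ω, (1 + M T ω ^ 2) ∂μ := by
        refine integral_mono ((hML T).integrable one_le_two).norm
          ((integrable_const 1).add (hML T).integrable_sq) fun ω => ?_
        change |M T ω| ≤ 1 + M T ω ^ 2
        nlinarith [sq_abs (M T ω), sq_nonneg (|M T ω| - 1), abs_nonneg (M T ω)]
    _ = 1 + ∑ t ∈ Finset.range T, ∫ ω, D t ω ^ 2 ∂μ := by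
        rw [integral_add (integrable_const 1) (hML T).integrable_sq, hvar]
        simp
    _ ≤ 1 + R := by linarith [hR T]

/-- The conditional variance is at most the conditional second moment. -/
theorem integral_sq_sub_condExp_le {m : MeasurableSpace Ω} (hm : m ≤ m0) {X : Ω → ℝ}
    (hX : MemLp X 2 μ) : ∫ ω, (X ω - (μ[X | m]) ω) ^ 2 ∂μ ≤ ∫ ω, X ω ^ 2 ∂μ := by
  have h1 : ∫ ω, (X ω - (μ[X | m]) ω) ^ 2 ∂μ = ∫ ω, (Var[X; μ | m]) ω ∂μ :=
    (integral_condExp hm).symm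
  have h2 : ∫ ω, X ω ^ 2 ∂μ = ∫ ω, (μ[X ^ 2 | m]) ω ∂μ := (integral_condExp hm).symm
  rw [h1, h2]
  exact integral_mono_ae integrable_condVar integrable_condExp (condVar_ae_le_condExp_sq hm hX)

theorem ae_exists_tendsto_sum_sub_condExp (F : Filtration ℕ m0) {X : ℕ → Ω → ℝ}
    (hX : ∀ t, StronglyMeasurable[F (t + 1)] (X t)) (hL : ∀ t, MemLp (X t) 2 μ) {R : ℝ}
    (hR : ∀ T, ∑ t ∈ Finset.range T, ∫ ω, X t ω ^ 2 ∂μ ≤ R) :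
    ∀ᵐ ω ∂μ, ∃ l, Tendsto (fun T => ∑ t ∈ Finset.range T, (X t ω - (μ[X t | F t]) ω))
      atTop (𝓝 l) := by
  refine ae_exists_tendsto_sum_of_condExp_eq_zero F (D := fun t => X t - μ[X t | F t])
    (fun t => (hX t).sub (stronglyMeasurable_condExp.mono (F.mono (Nat.le_succ t))))
    (fun t => (hL t).sub ((hL t).condExp one_le_two)) (fun t => ?_) (R := R) fun T =>
      (Finset.sum_le_sum fun t _ => integral_sq_sub_condExp_le (F.le t) (hL t)).trans (hR T)
  have h1 := condExp_sub (m := F t) ((hL t).integrable one_le_two)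
    (integrable_condExp (f := X t) (m := F t))
  have h2 : μ[μ[X t | F t] | F t] = μ[X t | F t] :=
    condExp_of_stronglyMeasurable (F.le t) stronglyMeasurable_condExp integrable_condExp
  filter_upwards [h1] with ω h1
  rw [h1, Pi.sub_apply, h2, sub_self, Pi.zero_apply]

omit [IsProbabilityMeasure μ] in
/-- A series of nonnegative functions with bounded integrals of partial sums converges. -/
theorem ae_exists_tendsto_sum_of_integral_le {a : ℕ → Ω → ℝ} (ha : ∀ t, Integrable (a t) μ)
    (h0 : ∀ t ω, 0 ≤ a t ω) {R : ℝ} (hR : ∀ T, ∑ t ∈ Finset.range T, ∫ ω, a t ω ∂μ ≤ R) :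
    ∀ᵐ ω ∂μ, ∃ l, Tendsto (fun T => ∑ t ∈ Finset.range T, a t ω) atTop (𝓝 l) := by
  have hfin : ∫⁻ ω, ∑' t, ENNReal.ofReal (a t ω) ∂μ ≠ ⊤ := by
    rw [lintegral_tsum fun t => (ha t).aestronglyMeasurable.aemeasurable.ennreal_ofReal]
    refine ne_top_of_le_ne_top (ENNReal.ofReal_ne_top (r := R)) ?_
    refine ENNReal.tsum_le_of_sum_range_le fun T => ?_
    simp only [← ofReal_integral_eq_lintegral_ofReal (ha _) (.of_forall (h0 _))]
    rw [← ENNReal.ofReal_sum_of_nonneg fun t _ => integral_nonneg (h0 t)]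
    exact ENNReal.ofReal_le_ofReal (hR T)
  have hm : AEMeasurable (fun ω => ∑' t, ENNReal.ofReal (a t ω)) μ :=
    .tsum fun t => (ha t).aestronglyMeasurable.aemeasurable.ennreal_ofReal
  filter_upwards [ae_lt_top' hm hfin] with ω hω
  have hs : Summable fun t => a t ω := by
    have h1 := ENNReal.summable_toReal hω.ne
    simpa only [ENNReal.toReal_ofReal (h0 _ ω)] using h1
  exact ⟨_, hs.hasSum.tendsto_sum_nat⟩

end Martingale

/-! ### Conditional estimates for the observation errors. -/

section Noise

variable {Ω : Type*} {m0 : MeasurableSpace Ω} {μ : Measure Ω} [IsProbabilityMeasure μ]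

omit [IsProbabilityMeasure μ] in
theorem integrable_mul_of_bound {f g : Ω → ℝ} (hf : StronglyMeasurable f) (hg : Integrable g μ)
    {C : ℝ} (hC : ∀ ω, |f ω| ≤ C) : Integrable (fun ω => f ω * g ω) μ :=
  hg.bdd_mul hf.aestronglyMeasurable (.of_forall hC)

variable {m : MeasurableSpace Ω} {ξ : Ω → ℝ} {K : ℝ}

/-- The linear term averages to zero and the quadratic one to at most `K * c`. Only an upper bound
on `X` is asked for, since the projection yields an inequality; the bounds on the coefficients serve
integrability. -/
theorem condExp_le_of_le_quadratic (hm : m ≤ m0) (hξ : MemLp ξ 2 μ) (h0 : μ[ξ | m] =ᵐ[μ] 0)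
    (hK : ∀ᵐ ω ∂μ, (μ[fun ω' => ξ ω' ^ 2 | m]) ω ≤ K) {X a b c : Ω → ℝ} (hX : Integrable X μ)
    (ha : StronglyMeasurable[m] a) (hb : StronglyMeasurable[m] b) (hc : StronglyMeasurable[m] c)
    (hc0 : ∀ ω, 0 ≤ c ω) {C : ℝ} (haC : ∀ ω, |a ω| ≤ C) (hbC : ∀ ω, |b ω| ≤ C)
    (hcC : ∀ ω, |c ω| ≤ C) (hle : ∀ ω, X ω ≤ a ω + b ω * ξ ω + c ω * ξ ω ^ 2) :
    ∀ᵐ ω ∂μ, (μ[X | m]) ω ≤ a ω + K * c ω := by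
  have hξ1 := hξ.integrable one_le_two
  have hξ2 := hξ.integrable_sq
  have ia : Integrable a μ :=
    (integrable_const C).mono' (ha.mono hm).aestronglyMeasurable (.of_forall haC)
  have ib : Integrable (b * ξ) μ := integrable_mul_of_bound (hb.mono hm) hξ1 hbC
  have ic : Integrable (c * fun ω => ξ ω ^ 2) μ := integrable_mul_of_bound (hc.mono hm) hξ2 hcC
  have h1 := condExp_mono (m := m) hX ((ia.add ib).add ic) (.of_forall hle)
  filter_upwards [h1, condExp_add (m := m) (ia.add ib) ic, condExp_add (m := m) ia ib,
    condExp_mul_of_stronglyMeasurable_left hb ib hξ1,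
    condExp_mul_of_stronglyMeasurable_left hc ic hξ2, h0, hK] with ω h1 h2 h3 h4 h5 h6 h7
  rw [h2, Pi.add_apply, h3, Pi.add_apply, h4, h5, Pi.mul_apply, Pi.mul_apply, h6,
    condExp_of_stronglyMeasurable hm ha ia] at h1
  simp only [Pi.zero_apply, mul_zero, add_zero] at h1
  nlinarith [hc0 ω]

theorem integral_mul_sq_le (hm : m ≤ m0) (hξ : MemLp ξ 2 μ)
    (hK : ∀ᵐ ω ∂μ, (μ[fun ω' => ξ ω' ^ 2 | m]) ω ≤ K) {c : Ω → ℝ}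
    (hc : StronglyMeasurable[m] c) (hc0 : ∀ ω, 0 ≤ c ω) {C : ℝ} (hcC : ∀ ω, c ω ≤ C) :
    ∫ ω, c ω * ξ ω ^ 2 ∂μ ≤ K * ∫ ω, c ω ∂μ := by
  have hcC' : ∀ ω, |c ω| ≤ C := fun ω => by rw [abs_of_nonneg (hc0 ω)]; exact hcC ω
  have ia : Integrable c μ :=
    (integrable_const C).mono' (hc.mono hm).aestronglyMeasurable (.of_forall hcC')
  have ic : Integrable (c * fun ω => ξ ω ^ 2) μ :=
    integrable_mul_of_bound (hc.mono hm) hξ.integrable_sq hcC'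
  have h1 : ∫ ω, c ω * ξ ω ^ 2 ∂μ = ∫ ω, (μ[c * fun ω => ξ ω ^ 2 | m]) ω ∂μ :=
    (integral_condExp hm).symm
  rw [h1, ← integral_const_mul]
  refine integral_mono_ae integrable_condExp (ia.const_mul K) ?_
  filter_upwards [condExp_mul_of_stronglyMeasurable_left hc ic hξ.integrable_sq, hK] with ω h1 h2
  rw [h1, Pi.mul_apply, mul_comm K]
  exact mul_le_mul_of_nonneg_left h2 (hc0 ω)

end Noise

/-! ### Convergent series driven by square summable steps. -/

section NoiseSeries

variable {Ω : Type*} {m0 : MeasurableSpace Ω} {μ : Measure Ω} [IsProbabilityMeasure μ]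
  {F : Filtration ℕ m0} {g ξ : ℕ → Ω → ℝ} {C K R A : ℝ}

theorem memLp_of_abs_le_mul {s : ℕ} {X : Ω → ℝ} (hX : AEStronglyMeasurable X μ)
    (hg : ∀ ω, |g s ω| ≤ C) (hξL : MemLp (ξ s) 2 μ)
    (hXle : ∀ ω, |X ω| ≤ A * (|g s ω| * (1 + |ξ s ω|))) (hA : 0 ≤ A) : MemLp X 2 μ := by
  refine MemLp.of_le_mul (c := A * C) ((memLp_const (1 : ℝ)).add hξL.norm) hX (.of_forall fun ω => ?_)
  have h1 : (0 : ℝ) ≤ 1 + |ξ s ω| := by positivity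
  have h2 : ‖((fun _ => (1 : ℝ)) + fun ω => ‖ξ s ω‖ : Ω → ℝ) ω‖ = 1 + |ξ s ω| := abs_of_nonneg h1
  rw [h2, Real.norm_eq_abs, mul_assoc]
  exact (hXle ω).trans (mul_le_mul_of_nonneg_left (mul_le_mul_of_nonneg_right (hg ω) h1) hA)

/-- The increments of the noise of a stochastic approximation method, centered by their
conditional expectations, form a convergent series. -/
theorem ae_exists_tendsto_sum_noise (hgm : ∀ t, StronglyMeasurable[F t] (g t))
    (hg : ∀ t ω, |g t ω| ≤ C) (hgR : ∀ T, ∑ t ∈ Finset.range T, ∫ ω, g t ω ^ 2 ∂μ ≤ R)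
    (hξL : ∀ t, MemLp (ξ t) 2 μ) (hK0 : 0 ≤ K)
    (hK : ∀ t, ∀ᵐ ω ∂μ, (μ[fun ω' => ξ t ω' ^ 2 | F t]) ω ≤ K) {X : ℕ → Ω → ℝ}
    (hX : ∀ t, StronglyMeasurable[F (t + 1)] (X t)) (hA : 0 ≤ A)
    (hXle : ∀ t ω, |X t ω| ≤ A * (|g t ω| * (1 + |ξ t ω|))) :
    ∀ᵐ ω ∂μ, ∃ l, Tendsto (fun T => ∑ t ∈ Finset.range T, (X t ω - (μ[X t | F t]) ω))
      atTop (𝓝 l) := by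
  have hXL : ∀ t, MemLp (X t) 2 μ := fun t => memLp_of_abs_le_mul
    ((hX t).mono (F.le _)).aestronglyMeasurable (hg t) (hξL t) (hXle t) hA
  have hg2 : ∀ t ω, g t ω ^ 2 ≤ C ^ 2 := fun t ω => by
    rw [← sq_abs]; exact pow_le_pow_left₀ (abs_nonneg _) (hg t ω) 2
  -- The constant comes from `(1 + |ξ|)² ≤ 2(1 + ξ²)` and the bound `K` on conditional second
  -- moments.
  refine ae_exists_tendsto_sum_sub_condExp F hX hXL (R := 2 * A ^ 2 * (1 + K) * R) fun T => ?_
  refine le_trans (Finset.sum_le_sum fun t _ => ?_) (?_ : ∑ t ∈ Finset.range T,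
    2 * A ^ 2 * (1 + K) * ∫ ω, g t ω ^ 2 ∂μ ≤ _)
  · have hsm : StronglyMeasurable[F t] fun ω => g t ω ^ 2 := (hgm t).pow 2
    have i1 : Integrable (fun ω => g t ω ^ 2) μ :=
      (integrable_const (C ^ 2)).mono' (hsm.mono (F.le t)).aestronglyMeasurable
        (.of_forall fun ω => by rw [Real.norm_of_nonneg (sq_nonneg _)]; exact hg2 t ω)
    have i2 : Integrable (fun ω => g t ω ^ 2 * ξ t ω ^ 2) μ :=
      integrable_mul_of_bound (C := C ^ 2) (hsm.mono (F.le t)) (hξL t).integrable_sq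
        fun ω => by rw [abs_of_nonneg (sq_nonneg _)]; exact hg2 t ω
    have h1 := integral_mul_sq_le (F.le t) (hξL t) (hK t) hsm (fun ω => sq_nonneg _) (hg2 t)
    calc ∫ ω, X t ω ^ 2 ∂μ
        ≤ ∫ ω, 2 * A ^ 2 * (g t ω ^ 2 + g t ω ^ 2 * ξ t ω ^ 2) ∂μ := by
          refine integral_mono (hXL t).integrable_sq ((i1.add i2).const_mul _) fun ω => ?_
          change X t ω ^ 2 ≤ 2 * A ^ 2 * (g t ω ^ 2 + g t ω ^ 2 * ξ t ω ^ 2)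
          rw [← sq_abs (X t ω), ← sq_abs (g t ω), ← sq_abs (ξ t ω)]
          refine (pow_le_pow_left₀ (abs_nonneg _) (hXle t ω) 2).trans ?_
          have := mul_nonneg (sq_nonneg (A * |g t ω|)) (sq_nonneg (1 - |ξ t ω|))
          nlinarith
      _ = 2 * A ^ 2 * (∫ ω, g t ω ^ 2 ∂μ + ∫ ω, g t ω ^ 2 * ξ t ω ^ 2 ∂μ) := by
          rw [integral_const_mul, integral_add i1 i2]
      _ ≤ 2 * A ^ 2 * (∫ ω, g t ω ^ 2 ∂μ + K * ∫ ω, g t ω ^ 2 ∂μ) := by gcongr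
      _ = _ := by ring
  · rw [← Finset.mul_sum]
    exact mul_le_mul_of_nonneg_left (hgR T) (by positivity)

theorem ae_exists_tendsto_sum_sq_mul (hgm : ∀ t, StronglyMeasurable[F t] (g t))
    (hg : ∀ t ω, |g t ω| ≤ C) (hgR : ∀ T, ∑ t ∈ Finset.range T, ∫ ω, g t ω ^ 2 ∂μ ≤ R)
    (hξL : ∀ t, MemLp (ξ t) 2 μ) (hK0 : 0 ≤ K)
    (hK : ∀ t, ∀ᵐ ω ∂μ, (μ[fun ω' => ξ t ω' ^ 2 | F t]) ω ≤ K) :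
    ∀ᵐ ω ∂μ, ∃ l, Tendsto (fun T => ∑ t ∈ Finset.range T, g t ω ^ 2 * (1 + ξ t ω ^ 2))
      atTop (𝓝 l) := by
  have hg2 : ∀ t ω, g t ω ^ 2 ≤ C ^ 2 := fun t ω => by
    rw [← sq_abs]; exact pow_le_pow_left₀ (abs_nonneg _) (hg t ω) 2
  have hsm : ∀ t, StronglyMeasurable[F t] fun ω => g t ω ^ 2 := fun t => (hgm t).pow 2
  have i1 : ∀ t, Integrable (fun ω => g t ω ^ 2) μ := fun t =>
    (integrable_const (C ^ 2)).mono' ((hsm t).mono (F.le t)).aestronglyMeasurable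
      (.of_forall fun ω => by rw [Real.norm_of_nonneg (sq_nonneg _)]; exact hg2 t ω)
  have i2 : ∀ t, Integrable (fun ω => g t ω ^ 2 * ξ t ω ^ 2) μ := fun t =>
    integrable_mul_of_bound (C := C ^ 2) ((hsm t).mono (F.le t)) (hξL t).integrable_sq
      fun ω => by rw [abs_of_nonneg (sq_nonneg _)]; exact hg2 t ω
  have e : ∀ t ω, g t ω ^ 2 * (1 + ξ t ω ^ 2) = g t ω ^ 2 + g t ω ^ 2 * ξ t ω ^ 2 :=
    fun t ω => by ring
  simp only [e]
  refine ae_exists_tendsto_sum_of_integral_le (fun t => (i1 t).add (i2 t))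
    (fun t ω => by positivity) (R := (1 + K) * R) fun T => ?_
  refine le_trans (Finset.sum_le_sum fun t _ => ?_) (?_ : ∑ t ∈ Finset.range T,
    (1 + K) * ∫ ω, g t ω ^ 2 ∂μ ≤ _)
  · have h1 := integral_mul_sq_le (F.le t) (hξL t) (hK t) (hsm t) (fun ω => sq_nonneg _) (hg2 t)
    rw [integral_add (i1 t) (i2 t)]
    linarith
  · rw [← Finset.mul_sum]
    exact mul_le_mul_of_nonneg_left (hgR T) (by positivity)

end NoiseSeries

/-! ### Functions that are Lipschitz on bounded sets. -/

section LipschitzOnBounded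

variable {E : Type*} [NormedAddCommGroup E]

/-- `f` is Lipschitz on every ball around the origin. -/
def LipschitzOnBounded (f : E → ℝ) : Prop :=
  ∀ C, ∃ L, 0 ≤ L ∧ ∀ x y, ‖x‖ ≤ C → ‖y‖ ≤ C → |f x - f y| ≤ L * ‖x - y‖

variable {f g : E → ℝ}

theorem LipschitzOnBounded.of_lipschitz {L : ℝ} (h : ∀ x y, |f x - f y| ≤ L * ‖x - y‖) :
    LipschitzOnBounded f := fun _ => ⟨|L|, abs_nonneg L, fun x y _ _ =>
  (h x y).trans (mul_le_mul_of_nonneg_right (le_abs_self L) (norm_nonneg _))⟩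

theorem LipschitzOnBounded.exists_bound (hf : LipschitzOnBounded f) (C : ℝ) :
    ∃ M, 0 ≤ M ∧ ∀ x, ‖x‖ ≤ C → |f x| ≤ M := by
  obtain ⟨L, hL, h⟩ := hf (max C 0)
  refine ⟨|f 0| + L * max C 0, by positivity, fun x hx => ?_⟩
  have hx' := hx.trans (le_max_left C 0)
  have h1 := h x 0 hx' (by simp)
  rw [sub_zero] at h1
  have h2 : |f x| ≤ |f x - f 0| + |f 0| := by
    simpa using abs_add_le (f x - f 0) (f 0)
  nlinarith [mul_le_mul_of_nonneg_left hx' hL]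

theorem LipschitzOnBounded.continuous (hf : LipschitzOnBounded f) : Continuous f := by
  refine continuous_iff_continuousAt.2 fun x => ?_
  obtain ⟨L, hL, h⟩ := hf (‖x‖ + 1)
  refine tendsto_iff_dist_tendsto_zero.2 ?_
  have h1 : Tendsto (fun y => L * ‖y - x‖) (𝓝 x) (𝓝 0) := by
    have : Continuous fun y => L * ‖y - x‖ := by fun_prop
    simpa using this.tendsto x
  refine squeeze_zero' (.of_forall fun y => dist_nonneg) ?_ h1
  filter_upwards [Metric.ball_mem_nhds x one_pos] with y hy
  rw [mem_ball_iff_norm] at hy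
  refine h y x ?_ (by linarith)
  linarith [norm_sub_norm_le y x]

theorem LipschitzOnBounded.const (c : ℝ) : LipschitzOnBounded fun _ : E => c :=
  .of_lipschitz (L := 0) fun x y => by simp

theorem LipschitzOnBounded.add (hf : LipschitzOnBounded f) (hg : LipschitzOnBounded g) :
    LipschitzOnBounded fun x => f x + g x := by
  intro C
  obtain ⟨L, hL, h⟩ := hf C
  obtain ⟨M, hM, h'⟩ := hg C
  refine ⟨L + M, by positivity, fun x y hx hy => ?_⟩
  rw [add_sub_add_comm, add_mul]
  exact (abs_add_le _ _).trans (add_le_add (h x y hx hy) (h' x y hx hy))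

theorem LipschitzOnBounded.mul (hf : LipschitzOnBounded f) (hg : LipschitzOnBounded g) :
    LipschitzOnBounded fun x => f x * g x := by
  intro C
  obtain ⟨L, hL, h⟩ := hf C
  obtain ⟨M, hM, h'⟩ := hg C
  obtain ⟨A, hA, hfA⟩ := hf.exists_bound C
  obtain ⟨B, hB, hgB⟩ := hg.exists_bound C
  refine ⟨L * B + A * M, by positivity, fun x y hx hy => ?_⟩
  have e : f x * g x - f y * g y = (f x - f y) * g x + f y * (g x - g y) := by ring
  rw [e]
  refine (abs_add_le _ _).trans ?_
  rw [abs_mul, abs_mul]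
  have h1 := mul_le_mul (h x y hx hy) (hgB x hx) (abs_nonneg _) (by positivity)
  have h2 := mul_le_mul (hfA y hy) (h' x y hx hy) (abs_nonneg _) hA
  linarith

theorem LipschitzOnBounded.const_mul (hf : LipschitzOnBounded f) (c : ℝ) :
    LipschitzOnBounded fun x => c * f x :=
  (LipschitzOnBounded.const c).mul hf

theorem LipschitzOnBounded.sum {ι : Type*} (s : Finset ι) {f : ι → E → ℝ}
    (hf : ∀ i, LipschitzOnBounded (f i)) : LipschitzOnBounded fun x => ∑ i ∈ s, f i x := by
  classical
  induction s using Finset.induction_on with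
  | empty => simpa using LipschitzOnBounded.const (E := E) 0
  | insert i s hi ih =>
    simp only [Finset.sum_insert hi]
    exact (hf i).add ih

theorem LipschitzOnBounded.exists_common {ι : Type*} [Fintype ι] {f : ι → E → ℝ}
    (hf : ∀ i, LipschitzOnBounded (f i)) (C : ℝ) :
    ∃ L, 0 ≤ L ∧ ∀ i x y, ‖x‖ ≤ C → ‖y‖ ≤ C → |f i x - f i y| ≤ L * ‖x - y‖ := by
  choose L hL h using fun i => hf i C
  refine ⟨∑ i, L i, Finset.sum_nonneg fun i _ => hL i, fun i x y hx hy => (h i x y hx hy).trans ?_⟩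
  exact mul_le_mul_of_nonneg_right
    (Finset.single_le_sum (fun i _ => hL i) (Finset.mem_univ i)) (norm_nonneg _)

theorem LipschitzOnBounded.exists_common_bound {ι : Type*} [Fintype ι] {f : ι → E → ℝ}
    (hf : ∀ i, LipschitzOnBounded (f i)) (C : ℝ) :
    ∃ M, 0 ≤ M ∧ ∀ i x, ‖x‖ ≤ C → |f i x| ≤ M := by
  choose L hL h using fun i => (hf i).exists_bound C
  refine ⟨∑ i, L i, Finset.sum_nonneg fun i _ => hL i, fun i x hx => (h i x hx).trans ?_⟩
  exact Finset.single_le_sum (fun i _ => hL i) (Finset.mem_univ i)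

end LipschitzOnBounded

/-! ### The temporal-difference drift and its lower bound. -/

section Field

variable {n m : ℕ} (σ : Fin n → (Fin n → ℝ) → (Fin n → ℝ) → ℝ) (P : Matrix (Fin n) (Fin n) ℝ)
  (c : Fin n → ℝ) (α : ℝ) (Φ : Matrix (Fin n) (Fin m) ℝ)

/-- The temporal difference with the exact value of the risk. -/
noncomputable def exactDiff (i : Fin n) (x : EuclideanSpace ℝ (Fin m)) : ℝ :=
  tempDiff c α Φ i x (σ i (P i) (approxValue Φ x))

/-- The drift of the squared distance to the point `pr x`. -/
noncomputable def driftTerm (pr : EuclideanSpace ℝ (Fin m) → EuclideanSpace ℝ (Fin m))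
    (i : Fin n) (x : EuclideanSpace ℝ (Fin m)) : ℝ :=
  exactDiff σ P c α Φ i x * inner ℝ (feature Φ i) (x - pr x)

variable {σ P c α Φ}

theorem approxValue_apply (x : EuclideanSpace ℝ (Fin m)) (i : Fin n) :
    approxValue Φ x i = inner ℝ (feature Φ i) x := by
  rw [PiLp.inner_apply]
  simp only [approxValue, Matrix.mulVec, dotProduct, feature, RCLike.inner_apply, conj_trivial]
  exact Finset.sum_congr rfl fun j _ => mul_comm _ _

theorem tempDiff_add_noise (i : Fin n) (x : EuclideanSpace ℝ (Fin m)) (s : ℝ) :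
    tempDiff c α Φ i x (σ i (P i) (approxValue Φ x) + s) = exactDiff σ P c α Φ i x - α * s := by
  simp only [exactDiff, tempDiff]
  ring

theorem lipschitzOnBounded_inner (y : EuclideanSpace ℝ (Fin m)) :
    LipschitzOnBounded fun x : EuclideanSpace ℝ (Fin m) => inner ℝ y x :=
  .of_lipschitz (L := ‖y‖) fun x z => by
    rw [← inner_sub_right]
    exact abs_real_inner_le_norm _ _

theorem lipschitzOnBounded_inner_sub
    {pr : EuclideanSpace ℝ (Fin m) → EuclideanSpace ℝ (Fin m)}
    (hpr : ∀ x y, ‖pr x - pr y‖ ≤ ‖x - y‖) (y : EuclideanSpace ℝ (Fin m)) :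
    LipschitzOnBounded fun x : EuclideanSpace ℝ (Fin m) => inner ℝ y (x - pr x) :=
  .of_lipschitz (L := ‖y‖ * 2) fun x z => by
    rw [← inner_sub_right, mul_assoc]
    refine (abs_real_inner_le_norm _ _).trans (mul_le_mul_of_nonneg_left ?_ (norm_nonneg y))
    rw [sub_sub_sub_comm]
    linarith [norm_sub_le (x - z) (pr x - pr z), hpr x z]

theorem exists_norm_approxValue_sub_le (Φ : Matrix (Fin n) (Fin m) ℝ) :
    ∃ A, 0 ≤ A ∧ ∀ x y, ‖approxValue Φ x - approxValue Φ y‖ ≤ A * ‖x - y‖ := by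
  refine ⟨∑ i, ‖feature Φ i‖, Finset.sum_nonneg fun i _ => norm_nonneg _, fun x y => ?_⟩
  refine (pi_norm_le_iff_of_nonneg (by positivity)).2 fun i => ?_
  rw [Pi.sub_apply, approxValue_apply, approxValue_apply, ← inner_sub_right]
  refine (abs_real_inner_le_norm _ _).trans (mul_le_mul_of_nonneg_right ?_ (norm_nonneg _))
  exact Finset.single_le_sum (f := fun i => ‖feature Φ i‖) (fun i _ => norm_nonneg _)
    (Finset.mem_univ i)

theorem lipschitzOnBounded_exactDiff (hσ : IsTransitionRiskMapping σ)
    (hP : ∀ i, P i ∈ stdSimplex ℝ (Fin n)) (i : Fin n) :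
    LipschitzOnBounded (exactDiff σ P c α Φ i) := by
  obtain ⟨A, hA, h⟩ := exists_norm_approxValue_sub_le Φ
  have h1 : LipschitzOnBounded fun x : EuclideanSpace ℝ (Fin m) =>
      σ i (P i) (approxValue Φ x) :=
    .of_lipschitz fun x y => ((hσ i (P i) (hP i)).abs_sub_le_norm _ _).trans (h x y)
  have e : exactDiff σ P c α Φ i = fun x : EuclideanSpace ℝ (Fin m) =>
      (inner ℝ (feature Φ i) x + -c i) + -α * σ i (P i) (approxValue Φ x) := by
    ext x
    simp only [exactDiff, tempDiff]
    ring
  rw [e]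
  exact ((lipschitzOnBounded_inner _).add (.const _)).add (h1.const_mul _)

theorem lipschitzOnBounded_driftTerm (hσ : IsTransitionRiskMapping σ)
    (hP : ∀ i, P i ∈ stdSimplex ℝ (Fin n))
    {pr : EuclideanSpace ℝ (Fin m) → EuclideanSpace ℝ (Fin m)}
    (hpr : ∀ x y, ‖pr x - pr y‖ ≤ ‖x - y‖) (i : Fin n) :
    LipschitzOnBounded (driftTerm σ P c α Φ pr i) :=
  (lipschitzOnBounded_exactDiff hσ hP i).mul (lipschitzOnBounded_inner_sub hpr _)

/-- Since `Φ (pr x) = v`, pairing a feature with `x - pr x` gives a component of `Φ x - v`. The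
Euclidean geometry of the coefficients thus meets the `q`-weighted geometry of the values, even if
`Φ` is not injective. -/
theorem mul_sum_sq_le_sum_driftTerm (hσ : IsTransitionRiskMapping σ)
    (hP : ∀ i, P i ∈ stdSimplex ℝ (Fin n))
    (hac : ∀ i, ∀ μ ∈ riskMultikernel σ i (P i), ∀ j, P i j = 0 → μ j = 0)
    {q : Fin n → ℝ} (hq : ∀ i, 0 < q i) (hqs : q ∈ stdSimplex ℝ (Fin n)) (hqP : q ᵥ* P = q)
    (hα₀ : 0 < α) {v : Fin n → ℝ} (hv : IsProjectedSolution σ P q c α Φ v)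
    {pr : EuclideanSpace ℝ (Fin m) → EuclideanSpace ℝ (Fin m)}
    (hpr : ∀ x, approxValue Φ (pr x) = v) (x : EuclideanSpace ℝ (Fin m)) :
    (1 - α * √(1 + distortion σ P)) * ∑ i, q i * (approxValue Φ x i - v i) ^ 2
      ≤ q ⬝ᵥ fun i => driftTerm σ P c α Φ pr i x := by
  refine (hv.drift_ge hq hσ hP hac hqs hqP hα₀ x.ofLp).trans_eq ?_
  refine Finset.sum_congr rfl fun i _ => ?_
  have h1 : inner ℝ (feature Φ i) (x - pr x) = approxValue Φ x i - v i := by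
    rw [inner_sub_right, ← approxValue_apply, ← approxValue_apply, hpr]
  simp only [driftTerm, h1, exactDiff, tempDiff, ← approxValue_apply, riskOp]
  rfl

/-- The mean drift is nonnegative, and is bounded away from zero on bounded sets away from
the set of solutions. -/
theorem exists_drift_lower_bound (hσ : IsTransitionRiskMapping σ)
    (hP : ∀ i, P i ∈ stdSimplex ℝ (Fin n))
    (hac : ∀ i, ∀ μ ∈ riskMultikernel σ i (P i), ∀ j, P i j = 0 → μ j = 0)
    {q : Fin n → ℝ} (hq : ∀ i, 0 < q i) (hqs : q ∈ stdSimplex ℝ (Fin n)) (hqP : q ᵥ* P = q)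
    (hα₀ : 0 < α) (hcontr : α * √(1 + distortion σ P) < 1)
    {v : Fin n → ℝ} (hv : IsProjectedSolution σ P q c α Φ v)
    {Y : Set (EuclideanSpace ℝ (Fin m))} (hYc : IsClosed Y)
    {pr : EuclideanSpace ℝ (Fin m) → EuclideanSpace ℝ (Fin m)}
    (hprL : ∀ x y, ‖pr x - pr y‖ ≤ ‖x - y‖) (hpr : ∀ x, approxValue Φ (pr x) = v)
    (hprY : ∀ x ∈ Y, approxValue Φ x = v → pr x = x) (C : ℝ) {η : ℝ} (hη : 0 < η) :
    ∃ δ > 0, ∀ x ∈ Y, ‖x‖ ≤ C → η ≤ ‖x - pr x‖ ^ 2 →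
      δ ≤ q ⬝ᵥ fun i => driftTerm σ P c α Φ pr i x := by
  have hcont : Continuous fun x => q ⬝ᵥ fun i => driftTerm σ P c α Φ pr i x := by
    refine continuous_finsetSum _ fun i _ => continuous_const.mul ?_
    exact (lipschitzOnBounded_driftTerm hσ hP hprL i).continuous
  have hprc : Continuous pr := (LipschitzWith.of_dist_le_mul (K := 1) fun x y => by
    simpa [dist_eq_norm] using hprL x y).continuous
  -- The mean drift attains its minimum on this compact set, and the minimizer, being off the
  -- solution set, has positive drift.
  have hcomp : IsCompact (Metric.closedBall (0 : EuclideanSpace ℝ (Fin m)) C ∩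
      (Y ∩ {x | η ≤ ‖x - pr x‖ ^ 2})) :=
    (isCompact_closedBall 0 C).inter_right
      (hYc.inter (isClosed_le continuous_const (by fun_prop)))
  rcases Set.eq_empty_or_nonempty (Metric.closedBall (0 : EuclideanSpace ℝ (Fin m)) C ∩
      (Y ∩ {x | η ≤ ‖x - pr x‖ ^ 2})) with he | hne
  · refine ⟨1, one_pos, fun x hxY hx hxη => ?_⟩
    have : x ∈ (∅ : Set (EuclideanSpace ℝ (Fin m))) := by
      rw [← he]
      exact ⟨mem_closedBall_zero_iff.2 hx, hxY, hxη⟩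
    exact absurd this (Set.notMem_empty x)
  · obtain ⟨a, ⟨-, haY, haη⟩, hmin⟩ := hcomp.exists_isMinOn hne hcont.continuousOn
    refine ⟨_, ?_, fun x hxY hx hxη => hmin ⟨mem_closedBall_zero_iff.2 hx, hxY, hxη⟩⟩
    refine lt_of_lt_of_le ?_ (mul_sum_sq_le_sum_driftTerm hσ hP hac hq hqs hqP hα₀ hv hpr a)
    have hne : approxValue Φ a ≠ v := by
      intro h
      change η ≤ ‖a - pr a‖ ^ 2 at haη
      rw [hprY a haY h, sub_self, norm_zero] at haη
      norm_num at haη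
      linarith
    obtain ⟨i, hi⟩ := Function.ne_iff.1 hne
    refine mul_pos (by linarith) (Finset.sum_pos' (fun i _ => by have := hq i; positivity)
      ⟨i, Finset.mem_univ i, mul_pos (hq i) ?_⟩)
    have := sub_ne_zero.2 hi
    positivity

end Field

/-! ### One projected step. -/

section Step

variable {E : Type*} [NormedAddCommGroup E] [InnerProductSpace ℝ E]

theorem IsArgmin.norm_sq_step_le {Y : Set E} (hY : Convex ℝ Y) {x p y φ : E} {a : ℝ}
    (hp : p ∈ Y) (hy : IsArgmin (fun z => ‖z - (x - a • φ)‖) Y y) :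
    ‖y - p‖ ^ 2 ≤ ‖x - p‖ ^ 2 - 2 * (a * inner ℝ φ (x - p)) + a ^ 2 * ‖φ‖ ^ 2 := by
  have h1 := hy.norm_sub_le_of_mem hY hp
  have h2 := pow_le_pow_left₀ (norm_nonneg _) h1 2
  refine h2.trans_eq ?_
  rw [sub_right_comm, norm_sub_sq_real, inner_smul_right, real_inner_comm, norm_smul, mul_pow,
    Real.norm_eq_abs, sq_abs]

theorem IsArgmin.norm_step_le {Y : Set E} (hY : Convex ℝ Y) {x y φ : E} {a : ℝ}
    (hx : x ∈ Y) (hy : IsArgmin (fun z => ‖z - (x - a • φ)‖) Y y) :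
    ‖y - x‖ ≤ |a| * ‖φ‖ := by
  refine (hy.norm_sub_le_of_mem hY hx).trans_eq ?_
  rw [sub_right_comm, sub_self, zero_sub, norm_neg, norm_smul, Real.norm_eq_abs]

/-- Truncation makes the square globally Lipschitz, so increments of the truncated squared distance
grow linearly, not quadratically, in the noise. -/
theorem abs_min_sq_sub_min_sq_le {a b c : ℝ} (ha : 0 ≤ a) (hb : 0 ≤ b) (hc : 0 ≤ c) :
    |min a c ^ 2 - min b c ^ 2| ≤ 2 * c * |a - b| := by
  have h1 : |min a c - min b c| ≤ |a - b| := by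
    simpa using abs_min_sub_min_le_max a c b c
  have h2 : |min a c + min b c| ≤ 2 * c := by
    rw [abs_of_nonneg (add_nonneg (le_min ha hc) (le_min hb hc))]
    linarith [min_le_right a c, min_le_right b c]
  rw [sq_sub_sq, abs_mul]
  exact mul_le_mul h2 h1 (abs_nonneg _) (by positivity)

end Step

/-! ### Histories, localization of the step size, and noise of the Markov chain. -/

section Trajectory

variable {n m : ℕ} {Ω : Type*} {m0 : MeasurableSpace Ω}
  {i : ℕ → Ω → Fin n} {r : ℕ → Ω → EuclideanSpace ℝ (Fin m)} {γ ξ : ℕ → Ω → ℝ}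

/-- The σ-algebras `F_t` as a filtration. -/
def historyFiltration (hi : ∀ t, Measurable (i t)) (hr : ∀ t, Measurable (r t)) :
    Filtration ℕ m0 where
  seq := history i r
  mono' _ _ hst := iSup_mono fun _ => iSup_mono' fun h => ⟨h.trans hst, le_rfl⟩
  le' _ := iSup_le fun s => iSup_le fun _ => sup_le (hi s).comap_le (hr s).comap_le

theorem measurable_state_history (t : ℕ) : Measurable[history i r t] (i t) :=
  Measurable.of_comap_le <| le_sup_left.trans <|
    le_iSup₂_of_le (f := fun s (_ : s ≤ t) => MeasurableSpace.comap (i s) inferInstance ⊔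
      MeasurableSpace.comap (r s) inferInstance) t le_rfl le_rfl

theorem measurable_coeff_history (t : ℕ) : Measurable[history i r t] (r t) :=
  Measurable.of_comap_le <| le_sup_right.trans <|
    le_iSup₂_of_le (f := fun s (_ : s ≤ t) => MeasurableSpace.comap (i s) inferInstance ⊔
      MeasurableSpace.comap (r s) inferInstance) t le_rfl le_rfl

theorem stronglyMeasurable_state_coeff {mΩ : MeasurableSpace Ω} {j : Ω → Fin n}
    {x : Ω → EuclideanSpace ℝ (Fin m)} (hj : Measurable j) (hx : Measurable x)
    {f : Fin n → EuclideanSpace ℝ (Fin m) → ℝ} (hf : ∀ k, Continuous (f k)) :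
    StronglyMeasurable fun ω => f (j ω) (x ω) := by
  have h : Measurable fun p : Fin n × EuclideanSpace ℝ (Fin m) => f p.1 p.2 :=
    measurable_from_prod_countable_right fun k => (hf k).measurable
  exact (h.comp (hj.prodMk hx)).stronglyMeasurable

/-- The event that the coefficients and the step size are within bounds at time `t`. -/
def boundedEvent (Y : Set (EuclideanSpace ℝ (Fin m))) (C : ℝ)
    (r : ℕ → Ω → EuclideanSpace ℝ (Fin m)) (γ : ℕ → Ω → ℝ) (t : ℕ) : Set Ω :=
  {ω | r t ω ∈ Y ∧ ‖r t ω‖ ≤ C ∧ 0 ≤ γ t ω ∧ γ t ω ≤ C}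

/-- The step size, replaced by zero outside of the event `boundedEvent`. -/
noncomputable def boundedStep (Y : Set (EuclideanSpace ℝ (Fin m))) (C : ℝ)
    (r : ℕ → Ω → EuclideanSpace ℝ (Fin m)) (γ : ℕ → Ω → ℝ) (t : ℕ) : Ω → ℝ :=
  (boundedEvent Y C r γ t).indicator (γ t)

variable {Y : Set (EuclideanSpace ℝ (Fin m))} {C : ℝ} {F : Filtration ℕ m0}

theorem measurableSet_boundedEvent (hY : IsClosed Y) (hr : ∀ t, Measurable[F t] (r t))
    (hγ : ∀ t, Measurable[F t] (γ t)) (t : ℕ) : MeasurableSet[F t] (boundedEvent Y C r γ t) := by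
  have h1 : MeasurableSet[F t] {ω | r t ω ∈ Y} := hr t hY.measurableSet
  have h2 : MeasurableSet[F t] {ω | ‖r t ω‖ ≤ C} :=
    hr t (measurableSet_le measurable_norm measurable_const)
  have h3 : MeasurableSet[F t] {ω | 0 ≤ γ t ω} := hγ t measurableSet_Ici
  have h4 : MeasurableSet[F t] {ω | γ t ω ≤ C} := hγ t measurableSet_Iic
  exact h1.inter (h2.inter (h3.inter h4))

theorem stronglyMeasurable_boundedStep (hY : IsClosed Y) (hr : ∀ t, Measurable[F t] (r t))
    (hγ : ∀ t, Measurable[F t] (γ t)) (t : ℕ) :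
    StronglyMeasurable[F t] (boundedStep Y C r γ t) :=
  ((hγ t).stronglyMeasurable).indicator (measurableSet_boundedEvent hY hr hγ t)

theorem boundedStep_of_mem {t : ℕ} {ω : Ω} (h : ω ∈ boundedEvent Y C r γ t) :
    boundedStep Y C r γ t ω = γ t ω := Set.indicator_of_mem h _

theorem boundedStep_of_notMem {t : ℕ} {ω : Ω} (h : ω ∉ boundedEvent Y C r γ t) :
    boundedStep Y C r γ t ω = 0 := Set.indicator_of_notMem h _

theorem boundedStep_nonneg (t : ℕ) (ω : Ω) : 0 ≤ boundedStep Y C r γ t ω :=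
  Set.indicator_apply_nonneg fun h => h.2.2.1

theorem abs_boundedStep_le (hC : 0 ≤ C) (t : ℕ) (ω : Ω) : |boundedStep Y C r γ t ω| ≤ C := by
  rw [abs_of_nonneg (boundedStep_nonneg t ω)]
  exact Set.indicator_apply_le' (fun h => h.2.2.2) fun _ => hC

/-- A bound for a product with the step size which is only needed on the bounded event. -/
theorem abs_boundedStep_mul_le (hC : 0 ≤ C) {M : ℝ} (hM : 0 ≤ M) {t : ℕ} {ω : Ω} {a : ℝ}
    (h : ‖r t ω‖ ≤ C → |a| ≤ M) : |boundedStep Y C r γ t ω * a| ≤ C * M := by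
  by_cases hω : ω ∈ boundedEvent Y C r γ t
  · rw [abs_mul]
    exact mul_le_mul (abs_boundedStep_le hC t ω) (h hω.2.1) (abs_nonneg _) hC
  · rw [boundedStep_of_notMem hω, zero_mul, abs_zero]
    positivity

variable {μ : Measure Ω} [IsProbabilityMeasure μ]

theorem exists_sum_integral_boundedStep_sq_le (hY : IsClosed Y)
    (hr : ∀ t, Measurable[F t] (r t)) (hγ : ∀ t, Measurable[F t] (γ t)) (hC : 0 ≤ C)
    (hsum : ∫⁻ ω, ∑' t, ENNReal.ofReal (γ t ω ^ 2) ∂μ < ⊤) :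
    ∃ R, ∀ T, ∑ t ∈ Finset.range T, ∫ ω, boundedStep Y C r γ t ω ^ 2 ∂μ ≤ R := by
  refine ⟨(∫⁻ ω, ∑' t, ENNReal.ofReal (γ t ω ^ 2) ∂μ).toReal, fun T => ?_⟩
  rw [← ENNReal.ofReal_le_iff_le_toReal hsum.ne,
    ENNReal.ofReal_sum_of_nonneg fun t _ => integral_nonneg fun ω => sq_nonneg _]
  have hm : ∀ t, AEMeasurable (fun ω => ENNReal.ofReal (γ t ω ^ 2)) μ := fun t =>
    ((((hγ t).mono (F.le t) le_rfl).pow_const 2).ennreal_ofReal).aemeasurable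
  rw [lintegral_tsum hm]
  refine le_trans (Finset.sum_le_sum fun t _ => ?_) (ENNReal.sum_le_tsum (Finset.range T))
  have hsm := ((stronglyMeasurable_boundedStep (C := C) hY hr hγ t).pow 2).mono (F.le t)
  have hint : Integrable (fun ω => boundedStep Y C r γ t ω ^ 2) μ :=
    (integrable_const (C ^ 2)).mono' hsm.aestronglyMeasurable (.of_forall fun ω => by
      rw [Real.norm_of_nonneg (sq_nonneg _), ← sq_abs]
      exact pow_le_pow_left₀ (abs_nonneg _) (abs_boundedStep_le hC t ω) 2)
  rw [ofReal_integral_eq_lintegral_ofReal hint (.of_forall fun ω => sq_nonneg _)]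
  refine lintegral_mono fun ω => ENNReal.ofReal_le_ofReal ?_
  by_cases hω : ω ∈ boundedEvent Y C r γ t
  · rw [boundedStep_of_mem hω]
  · rw [boundedStep_of_notMem hω]
    simp [sq_nonneg]

/-- The noise due to the transitions of the Markov chain. -/
theorem ae_exists_tendsto_sum_markov_noise {P : Matrix (Fin n) (Fin n) ℝ} {K : ℝ}
    (hi : ∀ t, Measurable[F t] (i t)) (hr : ∀ t, Measurable[F t] (r t))
    (hγ : ∀ t, Measurable[F t] (γ t)) (hY : IsClosed Y) (hC : 0 ≤ C)
    (hsum : ∫⁻ ω, ∑' t, ENNReal.ofReal (γ t ω ^ 2) ∂μ < ⊤)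
    (hmarkov : IsMarkovTrajectory μ P F i) (hξL : ∀ t, MemLp (ξ t) 2 μ) (hK0 : 0 ≤ K)
    (hK : ∀ t, ∀ᵐ ω ∂μ, (μ[fun ω' => ξ t ω' ^ 2 | F t]) ω ≤ K)
    {f : Fin n → EuclideanSpace ℝ (Fin m) → ℝ} (hf : ∀ j, LipschitzOnBounded (f j)) :
    ∀ᵐ ω ∂μ, ∃ l, Tendsto (fun T => ∑ t ∈ Finset.range T, boundedStep Y C r γ t ω *
      (f (i (t + 1) ω) (r t ω) - ∑ j, P (i t ω) j * f j (r t ω))) atTop (𝓝 l) := by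
  obtain ⟨R, hR⟩ := exists_sum_integral_boundedStep_sq_le (C := C) hY hr hγ hC hsum
  obtain ⟨M, hM, hfM⟩ := LipschitzOnBounded.exists_common_bound hf C
  set g := boundedStep Y C r γ with hg
  have hgm : ∀ t, StronglyMeasurable[F t] (g t) := stronglyMeasurable_boundedStep hY hr hγ
  let X : ℕ → Ω → ℝ := fun t ω => g t ω * f (i (t + 1) ω) (r t ω)
  have hXm : ∀ t, StronglyMeasurable[F (t + 1)] (X t) := fun t =>
    ((hgm t).mono (F.mono t.le_succ)).mul (stronglyMeasurable_state_coeff (hi (t + 1))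
      ((hr t).mono (F.mono t.le_succ) le_rfl) fun j => (hf j).continuous)
  -- The factor with `ξ` only fits the bound to the general noise lemma.
  have hXle : ∀ t ω, |X t ω| ≤ M * (|g t ω| * (1 + |ξ t ω|)) := by
    intro t ω
    by_cases hω : ω ∈ boundedEvent Y C r γ t
    · rw [abs_mul, mul_left_comm]
      refine mul_le_mul_of_nonneg_left ((hfM _ _ hω.2.1).trans ?_) (abs_nonneg _)
      exact le_mul_of_one_le_right hM (by linarith [abs_nonneg (ξ t ω)])
    · simp only [X, hg, boundedStep_of_notMem hω, zero_mul, abs_zero, mul_zero, le_refl]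
  have hcond : ∀ t, μ[X t | F t] =ᵐ[μ] fun ω => g t ω * ∑ j, P (i t ω) j * f j (r t ω) := by
    intro t
    let I : Fin n → Ω → ℝ := fun j => (i (t + 1) ⁻¹' {j}).indicator fun _ => (1 : ℝ)
    let b : Fin n → Ω → ℝ := fun j ω => g t ω * f j (r t ω)
    have hbm : ∀ j, StronglyMeasurable[F t] (b j) := fun j =>
      (hgm t).mul ((hf j).continuous.measurable.comp (hr t)).stronglyMeasurable
    have hI : ∀ j, Integrable (I j) μ := fun j => (integrable_const (1 : ℝ)).indicator
      (((hi (t + 1)).mono (F.le _) le_rfl) (measurableSet_singleton j))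
    have hbI : ∀ j, Integrable (b j * I j) μ := fun j =>
      integrable_mul_of_bound ((hbm j).mono (F.le t)) (hI j) (C := C * M) fun ω =>
        abs_boundedStep_mul_le hC hM fun h => hfM j _ h
    -- Splitting over the next state leaves `F t`-measurable coefficients times indicators. This
    -- works because `f` is evaluated at `r t`, not at `r (t + 1)`.
    have hX : X t = ∑ j, b j * I j := by
      ext ω
      rw [Finset.sum_apply, Finset.sum_eq_single (i (t + 1) ω)]
      · simp [X, b, I]
      · intro j _ hj
        simp [I, hj.symm]
      · simp
    rw [hX]
    have h1 := condExp_finsetSum (s := Finset.univ) (fun j _ => hbI j) (F t)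
    have h2 : ∀ᵐ ω ∂μ, ∀ j, (μ[b j * I j | F t]) ω = b j ω * (μ[I j | F t]) ω :=
      ae_all_iff.2 fun j => condExp_mul_of_stronglyMeasurable_left (hbm j) (hbI j) (hI j)
    have h3 : ∀ᵐ ω ∂μ, ∀ j, (μ[I j | F t]) ω = P (i t ω) j := ae_all_iff.2 fun j => hmarkov t j
    filter_upwards [h1, h2, h3] with ω h1 h2 h3
    rw [h1, Finset.sum_apply, Finset.mul_sum]
    refine Finset.sum_congr rfl fun j _ => ?_
    rw [h2, h3]
    simp only [b]
    ring
  have hmain := ae_exists_tendsto_sum_noise hgm (abs_boundedStep_le hC) hR hξL hK0 hK hXm hM hXle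
  filter_upwards [hmain, ae_all_iff.2 hcond] with ω h1 h2
  simpa only [h2, X, ← mul_sub] using h1

end Trajectory

/-! ### The recursion for the squared distance to the solutions. -/

section Distance

variable {n m : ℕ} {Ω : Type*} {m0 : MeasurableSpace Ω} {μ : Measure Ω} [IsProbabilityMeasure μ]
  {i : ℕ → Ω → Fin n} {r : ℕ → Ω → EuclideanSpace ℝ (Fin m)} {γ ξ : ℕ → Ω → ℝ}
  {Y : Set (EuclideanSpace ℝ (Fin m))} {C : ℝ} {F : Filtration ℕ m0}
  {σ : Fin n → (Fin n → ℝ) → (Fin n → ℝ) → ℝ} {P : Matrix (Fin n) (Fin n) ℝ}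
  {c : Fin n → ℝ} {α K : ℝ} {Φ : Matrix (Fin n) (Fin m) ℝ}
  {pr : EuclideanSpace ℝ (Fin m) → EuclideanSpace ℝ (Fin m)}

theorem exists_norm_feature_le (Φ : Matrix (Fin n) (Fin m) ℝ) :
    ∃ B, 0 ≤ B ∧ ∀ j, ‖feature Φ j‖ ≤ B :=
  ⟨∑ j, ‖feature Φ j‖, Finset.sum_nonneg fun _ _ => norm_nonneg _, fun j =>
    Finset.single_le_sum (f := fun j => ‖feature Φ j‖) (fun _ _ => norm_nonneg _)
      (Finset.mem_univ j)⟩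

/-- On the bounded event, the increments of the coefficients are of the order of the step. -/
theorem exists_norm_increment_le (hσ : IsTransitionRiskMapping σ)
    (hP : ∀ i, P i ∈ stdSimplex ℝ (Fin n)) (hα₀ : 0 < α) (hYc : Convex ℝ Y)
    (hstep : ∀ t ω, IsArgmin (fun z => ‖z - (r t ω - (γ t ω *
      (exactDiff σ P c α Φ (i t ω) (r t ω) - α * ξ t ω)) • feature Φ (i t ω))‖) Y (r (t + 1) ω)) :
    ∃ A, 0 ≤ A ∧ ∀ t, ∀ ω ∈ boundedEvent Y C r γ t,
      ‖r (t + 1) ω - r t ω‖ ≤ A * (γ t ω * (1 + |ξ t ω|)) := by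
  obtain ⟨B, hB, hΦ⟩ := exists_norm_feature_le Φ
  obtain ⟨M, hM, hd⟩ := LipschitzOnBounded.exists_common_bound
    (fun j => lipschitzOnBounded_exactDiff (c := c) (α := α) (Φ := Φ) hσ hP j) C
  refine ⟨(M + α) * B, by positivity, fun t ω hω => ?_⟩
  obtain ⟨hωY, hωC, hγ0, -⟩ := hω
  refine ((hstep t ω).norm_step_le hYc hωY).trans ?_
  rw [abs_mul, abs_of_nonneg hγ0]
  have h1 : |exactDiff σ P c α Φ (i t ω) (r t ω) - α * ξ t ω| ≤ (M + α) * (1 + |ξ t ω|) := by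
    refine (abs_sub _ _).trans ?_
    rw [abs_mul, abs_of_pos hα₀]
    nlinarith [hd (i t ω) _ hωC, abs_nonneg (ξ t ω), mul_nonneg hM (abs_nonneg (ξ t ω))]
  calc γ t ω * |exactDiff σ P c α Φ (i t ω) (r t ω) - α * ξ t ω| * ‖feature Φ (i t ω)‖
      ≤ γ t ω * ((M + α) * (1 + |ξ t ω|)) * B := by
        gcongr
        exact hΦ _
    _ = _ := by ring

/-- The squared distance to the set of solutions decreases along the mean drift, up to a
convergent series of errors. -/
theorem exists_distance_recursion (hσ : IsTransitionRiskMapping σ)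
    (hP : ∀ i, P i ∈ stdSimplex ℝ (Fin n)) (hα₀ : 0 < α) (hYcl : IsClosed Y) (hYc : Convex ℝ Y)
    (hi : ∀ t, Measurable[F t] (i t)) (hr : ∀ t, Measurable[F t] (r t))
    (hγ : ∀ t, Measurable[F t] (γ t)) (hC : 0 ≤ C)
    (hsum : ∫⁻ ω, ∑' t, ENNReal.ofReal (γ t ω ^ 2) ∂μ < ⊤)
    (hξL : ∀ t, MemLp (ξ t) 2 μ) (hξ0 : ∀ t, μ[ξ t | F t] =ᵐ[μ] 0) (hK0 : 0 ≤ K)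
    (hK : ∀ t, ∀ᵐ ω ∂μ, (μ[fun ω' => ξ t ω' ^ 2 | F t]) ω ≤ K)
    (hstep : ∀ t ω, IsArgmin (fun z => ‖z - (r t ω - (γ t ω *
      (exactDiff σ P c α Φ (i t ω) (r t ω) - α * ξ t ω)) • feature Φ (i t ω))‖) Y (r (t + 1) ω))
    (hprL : ∀ x y, ‖pr x - pr y‖ ≤ ‖x - y‖) (hprY : ∀ x, pr x ∈ Y)
    (hprmin : ∀ x y, ‖y - pr y‖ ≤ ‖y - pr x‖) :
    ∃ B, 0 ≤ B ∧ ∃ δ : ℕ → Ω → ℝ, ∀ᵐ ω ∂μ,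
      (∃ l, Tendsto (fun T => ∑ t ∈ Finset.range T, δ t ω) atTop (𝓝 l)) ∧
      ∀ t, ω ∈ boundedEvent Y C r γ t → ω ∈ boundedEvent Y C r γ (t + 1) →
        ‖r (t + 1) ω - pr (r (t + 1) ω)‖ ^ 2 ≤ ‖r t ω - pr (r t ω)‖ ^ 2
          - 2 * (γ t ω * driftTerm σ P c α Φ pr (i t ω) (r t ω)) + B * γ t ω ^ 2 + δ t ω := by
  obtain ⟨R, hR⟩ := exists_sum_integral_boundedStep_sq_le (C := C) hYcl hr hγ hC hsum
  obtain ⟨A, hA, hinc⟩ := exists_norm_increment_le (C := C) hσ hP hα₀ hYc hstep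
  obtain ⟨N, hN, hΦ⟩ := exists_norm_feature_le Φ
  have hdL := fun j => lipschitzOnBounded_exactDiff (c := c) (α := α) (Φ := Φ) hσ hP j
  have hhL := fun j => lipschitzOnBounded_driftTerm (c := c) (α := α) (Φ := Φ) hσ hP hprL j
  have hβL := fun j => lipschitzOnBounded_inner_sub hprL (feature Φ j)
  have hDlip : ∀ x y : EuclideanSpace ℝ (Fin m),
      |‖x - pr x‖ - ‖y - pr y‖| ≤ 2 * ‖x - y‖ := by
    intro x y
    refine (abs_norm_sub_norm_le _ _).trans ?_
    rw [sub_sub_sub_comm]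
    linarith [norm_sub_le (x - y) (pr x - pr y), hprL x y]
  obtain ⟨Md, hMd, hd⟩ := LipschitzOnBounded.exists_common_bound hdL C
  obtain ⟨Mh, hMh, hh⟩ := LipschitzOnBounded.exists_common_bound hhL C
  obtain ⟨Mβ, hMβ, hβ⟩ := LipschitzOnBounded.exists_common_bound hβL C
  have hDL : LipschitzOnBounded fun x => ‖x - pr x‖ := .of_lipschitz hDlip
  obtain ⟨b, hb, hD⟩ := hDL.exists_bound C
  -- The next iterate may leave the ball of radius `C`. Truncating at the bound `b` valid on the
  -- ball keeps the increments square integrable with only second moments of `ξ`. `W` is exact on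
  -- the ball and nowhere larger than the squared distance, so upper bounds on increments survive.
  let W : EuclideanSpace ℝ (Fin m) → ℝ := fun x => min ‖x - pr x‖ b ^ 2
  have hWcont : Continuous W := (hDL.continuous.min continuous_const).pow 2
  have hWeq : ∀ x, ‖x‖ ≤ C → W x = ‖x - pr x‖ ^ 2 := by
    intro x hx
    have := hD x hx
    rw [abs_of_nonneg (norm_nonneg _)] at this
    simp only [W, min_eq_left this]
  have hWle : ∀ x, W x ≤ ‖x - pr x‖ ^ 2 := fun x =>
    pow_le_pow_left₀ (le_min (norm_nonneg _) hb) (min_le_left _ _) 2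
  set g := boundedStep Y C r γ with hg
  have hgm : ∀ t, StronglyMeasurable[F t] (g t) := stronglyMeasurable_boundedStep hYcl hr hγ
  have hg2 : ∀ t ω, |g t ω ^ 2| ≤ C ^ 2 := fun t ω => by
    rw [abs_pow]; exact pow_le_pow_left₀ (abs_nonneg _) (abs_boundedStep_le hC t ω) 2
  let X : ℕ → Ω → ℝ := fun t =>
    (boundedEvent Y C r γ t).indicator fun ω => W (r (t + 1) ω) - W (r t ω)
  have hXm : ∀ t, StronglyMeasurable[F (t + 1)] (X t) := by
    intro t
    have h1 : StronglyMeasurable[F (t + 1)] fun ω => W (r (t + 1) ω) :=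
      (hWcont.measurable.comp (hr (t + 1))).stronglyMeasurable
    have h2 : StronglyMeasurable[F t] fun ω => W (r t ω) :=
      (hWcont.measurable.comp (hr t)).stronglyMeasurable
    exact (h1.sub (h2.mono (F.mono t.le_succ))).indicator
      (F.mono t.le_succ _ (measurableSet_boundedEvent hYcl hr hγ t))
  have hXle : ∀ t ω, |X t ω| ≤ 2 * b * (2 * A) * (|g t ω| * (1 + |ξ t ω|)) := by
    intro t ω
    by_cases hω : ω ∈ boundedEvent Y C r γ t
    · simp only [X, hg, Set.indicator_of_mem hω, boundedStep_of_mem hω, abs_of_nonneg hω.2.2.1]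
      refine (abs_min_sq_sub_min_sq_le (norm_nonneg _) (norm_nonneg _) hb).trans ?_
      rw [mul_assoc (2 * b), mul_assoc 2 A]
      refine mul_le_mul_of_nonneg_left ((hDlip _ _).trans ?_) (by positivity)
      exact mul_le_mul_of_nonneg_left (hinc t ω hω) zero_le_two
    · simp only [X, hg, Set.indicator_of_notMem hω, boundedStep_of_notMem hω, zero_mul, abs_zero,
        mul_zero, le_refl]
  have hXint : ∀ t, Integrable (X t) μ := fun t =>
    (memLp_of_abs_le_mul ((hXm t).mono (F.le _)).aestronglyMeasurable (abs_boundedStep_le hC t)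
      (hξL t) (hXle t) (by positivity)).integrable one_le_two
  have hcond : ∀ t, ∀ᵐ ω ∂μ, (μ[X t | F t]) ω
      ≤ (g t ω * (-2 * driftTerm σ P c α Φ pr (i t ω) (r t ω)) + g t ω ^ 2 * (2 * N ^ 2 * Md ^ 2))
        + K * (g t ω ^ 2 * (2 * N ^ 2 * α ^ 2)) := by
    intro t
    refine condExp_le_of_le_quadratic (F.le t) (hξL t) (hξ0 t) (hK t) (hXint t)
      (b := fun ω => g t ω * (2 * α * inner ℝ (feature Φ (i t ω)) (r t ω - pr (r t ω))))
      (C := C * (2 * Mh) + C ^ 2 * (2 * N ^ 2 * Md ^ 2) + C * (2 * α * Mβ)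
        + C ^ 2 * (2 * N ^ 2 * α ^ 2)) ?_ ?_ ?_ (fun ω => by positivity) ?_ ?_ ?_ ?_
    · exact ((hgm t).mul ((stronglyMeasurable_state_coeff (hi t) (hr t)
        fun j => (hhL j).continuous).const_mul (-2))).add (((hgm t).pow 2).mul_const _)
    · exact (hgm t).mul ((stronglyMeasurable_state_coeff (hi t) (hr t)
        fun j => (hβL j).continuous).const_mul (2 * α))
    · exact ((hgm t).pow 2).mul_const _
    · intro ω
      have h1 : |g t ω * (-2 * driftTerm σ P c α Φ pr (i t ω) (r t ω))| ≤ C * (2 * Mh) :=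
        abs_boundedStep_mul_le hC (by positivity) fun h => by
          rw [abs_mul]
          norm_num
          exact hh _ _ h
      have h2 : |g t ω ^ 2 * (2 * N ^ 2 * Md ^ 2)| ≤ C ^ 2 * (2 * N ^ 2 * Md ^ 2) := by
        rw [abs_mul, abs_of_nonneg (show 0 ≤ 2 * N ^ 2 * Md ^ 2 by positivity)]
        exact mul_le_mul_of_nonneg_right (hg2 t ω) (by positivity)
      refine (abs_add_le _ _).trans ?_
      have : 0 ≤ C * (2 * α * Mβ) + C ^ 2 * (2 * N ^ 2 * α ^ 2) := by positivity
      linarith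
    · intro ω
      have h1 : |g t ω * (2 * α * inner ℝ (feature Φ (i t ω)) (r t ω - pr (r t ω)))|
          ≤ C * (2 * α * Mβ) :=
        abs_boundedStep_mul_le hC (by positivity) fun h => by
          rw [abs_mul, abs_of_pos (by positivity : 0 < 2 * α)]
          exact mul_le_mul_of_nonneg_left (hβ _ _ h) (by positivity)
      have : 0 ≤ C * (2 * Mh) + C ^ 2 * (2 * N ^ 2 * Md ^ 2) + C ^ 2 * (2 * N ^ 2 * α ^ 2) := by
        positivity
      linarith
    · intro ω
      rw [abs_mul, abs_of_nonneg (show 0 ≤ 2 * N ^ 2 * α ^ 2 by positivity)]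
      have h1 := mul_le_mul_of_nonneg_right (hg2 t ω) (show 0 ≤ 2 * N ^ 2 * α ^ 2 by positivity)
      have : 0 ≤ C * (2 * Mh) + C ^ 2 * (2 * N ^ 2 * Md ^ 2) + C * (2 * α * Mβ) := by positivity
      linarith
    · intro ω
      by_cases hω : ω ∈ boundedEvent Y C r γ t
      · simp only [X, hg, Set.indicator_of_mem hω, boundedStep_of_mem hω]
        obtain ⟨hωY, hωC, hγ0, -⟩ := hω
        rw [hWeq _ hωC]
        set x := r t ω
        set φ := feature Φ (i t ω)
        have h1 := (hstep t ω).norm_sq_step_le hYc (hprY x)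
        -- The new point is compared with the old nearest solution `pr x`, which the step inequality
        -- can use because it lies in `Y`.
        have h2 : W (r (t + 1) ω) ≤ ‖r (t + 1) ω - pr x‖ ^ 2 := by
          exact (hWle _).trans (pow_le_pow_left₀ (norm_nonneg _) (hprmin _ _) 2)
        have h3 : ‖φ‖ ^ 2 ≤ N ^ 2 := pow_le_pow_left₀ (norm_nonneg _) (hΦ _) 2
        set d := exactDiff σ P c α Φ (i t ω) x with hdd
        have h4 : d ^ 2 ≤ Md ^ 2 := by
          rw [← sq_abs]; exact pow_le_pow_left₀ (abs_nonneg _) (hd _ _ hωC) 2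
        have h5 : (γ t ω * (d - α * ξ t ω)) ^ 2 * ‖φ‖ ^ 2
            ≤ γ t ω ^ 2 * (2 * (Md ^ 2 + α ^ 2 * ξ t ω ^ 2)) * N ^ 2 := by
          rw [mul_pow]
          refine mul_le_mul (mul_le_mul_of_nonneg_left ?_ (sq_nonneg _)) h3 (sq_nonneg _)
            (by positivity)
          nlinarith [sq_nonneg (d + α * ξ t ω)]
        have h6 : driftTerm σ P c α Φ pr (i t ω) x = d * inner ℝ φ (x - pr x) := rfl
        rw [h6]
        linarith
      · simp only [X, hg, Set.indicator_of_notMem hω, boundedStep_of_notMem hω]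
        norm_num
  have hmain := ae_exists_tendsto_sum_noise hgm (abs_boundedStep_le hC) hR hξL hK0 hK hXm
    (by positivity) hXle
  refine ⟨2 * N ^ 2 * Md ^ 2 + K * (2 * N ^ 2 * α ^ 2), by positivity,
    fun t ω => X t ω - (μ[X t | F t]) ω, ?_⟩
  filter_upwards [hmain, ae_all_iff.2 hcond] with ω h1 h2
  refine ⟨h1, fun t ht ht' => ?_⟩
  have h3 := h2 t
  have h4 : X t ω = ‖r (t + 1) ω - pr (r (t + 1) ω)‖ ^ 2 - ‖r t ω - pr (r t ω)‖ ^ 2 := by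
    simp only [X, Set.indicator_of_mem ht]
    rw [hWeq _ ht.2.1, hWeq _ ht'.2.1]
  rw [hg, boundedStep_of_mem ht] at h3
  linarith

end Distance

/-- Unit windows suffice, so the variation condition is needed for `ε = 1` only; the empty half-open
window is treated apart. -/
theorem SmallOnWindows.of_variation {γ : ℕ → ℝ} (hγ : ∀ t, 0 < γ t)
    (hγ0 : Tendsto γ atTop (𝓝 0))
    (hvar : Tendsto (fun t₀ : ℕ => ⨆ T : ℕ, ⨆ _ : ∑ t ∈ Finset.Icc t₀ T, γ t ≤ 1,
      ENNReal.ofReal (∑ t ∈ Finset.Icc t₀ T, |γ t - γ (t + 1)|)) atTop (𝓝 0)) :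
    SmallOnWindows γ fun t => |γ t - γ (t + 1)| := by
  refine .of_unit_windows hγ hγ0 fun ε hε => ?_
  obtain ⟨N, hN⟩ := eventually_atTop.1
    (hvar.eventually_le_const (u := ENNReal.ofReal ε) (by simpa using hε))
  refine ⟨N, fun s hs t ht hsum => ?_⟩
  rcases ht.eq_or_lt with rfl | hlt
  · simpa using hε.le
  · obtain ⟨T, rfl⟩ : ∃ T, t = T + 1 := ⟨t - 1, by lia⟩
    rw [Finset.Ico_add_one_right_eq_Icc] at hsum ⊢
    have h1 := (le_iSup₂_of_le (f := fun T (_ : ∑ t ∈ Finset.Icc s T, γ t ≤ 1) =>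
      ENNReal.ofReal (∑ t ∈ Finset.Icc s T, |γ t - γ (t + 1)|)) T hsum le_rfl).trans (hN s hs)
    exact (ENNReal.ofReal_le_ofReal_iff hε.le).1 h1

/-! ### Averaging out the Markov chain and convergence to the solutions. -/

section Convergence

variable {n m : ℕ} {Ω : Type*} {m0 : MeasurableSpace Ω} {μ : Measure Ω} [IsProbabilityMeasure μ]
  {σ : Fin n → (Fin n → ℝ) → (Fin n → ℝ) → ℝ} {P : Matrix (Fin n) (Fin n) ℝ}
  {q c : Fin n → ℝ} {α : ℝ} {Φ : Matrix (Fin n) (Fin m) ℝ}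
  {i : ℕ → Ω → Fin n} {r : ℕ → Ω → EuclideanSpace ℝ (Fin m)} {γ ξ : ℕ → Ω → ℝ}
  {Y : Set (EuclideanSpace ℝ (Fin m))} {v : Fin n → ℝ}

theorem convex_inter_approxValue_eq (hYc : Convex ℝ Y) :
    Convex ℝ (Y ∩ {y | approxValue Φ y = v}) := by
    refine hYc.inter fun x hx y hy a b _ _ hab => ?_
    rw [Set.mem_ofPred_eq] at hx hy ⊢
    ext j
    have h1 := congrFun hx j
    have h2 := congrFun hy j
    rw [approxValue_apply] at h1 h2 ⊢
    rw [inner_add_right, inner_smul_right, inner_smul_right, h1, h2, ← add_mul, hab, one_mul]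

/-- On the event that the coefficients and the step sizes are bounded by `C`, the distance to
the set of solutions tends to zero. -/
theorem ae_tendsto_distance_of_bounded (hσ : IsTransitionRiskMapping σ)
    (hP : ∀ i, P i ∈ stdSimplex ℝ (Fin n)) (hirr : P.IsIrreducible)
    (hqs : q ∈ stdSimplex ℝ (Fin n)) (hqP : q ᵥ* P = q)
    (hac : ∀ i, ∀ μ ∈ riskMultikernel σ i (P i), ∀ j, P i j = 0 → μ j = 0)
    (hα₀ : 0 < α) (hcontr : α * √(1 + distortion σ P) < 1)
    (hv : IsProjectedSolution σ P q c α Φ v)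
    (hi : ∀ t, Measurable (i t)) (hr : ∀ t, Measurable (r t))
    (hmarkov : IsMarkovTrajectory μ P (history i r) i)
    (hγ : StepsizeCondition μ (history i r) γ) (hξ : ErrorCondition μ (history i r) ξ)
    (hYcl : IsClosed Y) (hYc : Convex ℝ Y)
    (hstep : ∀ t ω, IsArgmin (fun z => ‖z - (r t ω - (γ t ω *
      (exactDiff σ P c α Φ (i t ω) (r t ω) - α * ξ t ω)) • feature Φ (i t ω))‖) Y (r (t + 1) ω))
    {pr : EuclideanSpace ℝ (Fin m) → EuclideanSpace ℝ (Fin m)}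
    (hpr : ∀ x, IsArgmin (fun z => ‖z - x‖) (Y ∩ {y | approxValue Φ y = v}) (pr x))
    {C : ℝ} (hC : 0 ≤ C) :
    ∀ᵐ ω ∂μ, (∀ t, ‖r t ω‖ ≤ C) → (∀ t, γ t ω ≤ C) →
      Tendsto (fun t => ‖r t ω - pr (r t ω)‖ ^ 2) atTop (𝓝 0) := by
  have hq := stationary_pos hP hirr hqs hqP
  let F := historyFiltration hi hr
  have hiF : ∀ t, Measurable[F t] (i t) := measurable_state_history
  have hrF : ∀ t, Measurable[F t] (r t) := measurable_coeff_history
  have hconv := convex_inter_approxValue_eq (Φ := Φ) (v := v) hYc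
  have hprL : ∀ x y, ‖pr x - pr y‖ ≤ ‖x - y‖ := fun x y => (hpr x).norm_sub_le hconv (hpr y)
  have hprv : ∀ x, approxValue Φ (pr x) = v := fun x => (hpr x).1.2
  have hprfix : ∀ x ∈ Y, approxValue Φ x = v → pr x = x := fun x hx hxv => by
    have := (hpr x).norm_sub_le_of_mem hconv ⟨hx, hxv⟩
    rw [sub_self, norm_zero] at this
    exact sub_eq_zero.1 (norm_le_zero_iff.1 this)
  have hprmin : ∀ x y, ‖y - pr y‖ ≤ ‖y - pr x‖ := fun x y => by
    rw [norm_sub_rev y, norm_sub_rev y]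
    exact (hpr y).2 _ (hpr x).1
  obtain ⟨K₀, hK₀⟩ := hξ.bounded
  have hK : ∀ t, ∀ᵐ ω ∂μ, (μ[fun ω' => ξ t ω' ^ 2 | F t]) ω ≤ max K₀ 0 := fun t => by
    filter_upwards [hK₀ t] with ω h using h.trans (le_max_left _ _)
  obtain ⟨Z, hZ⟩ := exists_poisson hP hirr hqs hqP
  let h : Fin n → EuclideanSpace ℝ (Fin m) → ℝ := driftTerm σ P c α Φ pr
  let f : Fin n → EuclideanSpace ℝ (Fin m) → ℝ := fun j x => ∑ k, Z j k * h k x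
  have hf : ∀ j, LipschitzOnBounded (f j) := fun j => .sum _ fun k =>
    (lipschitzOnBounded_driftTerm hσ hP hprL k).const_mul _
  obtain ⟨L, hL, hfL⟩ := LipschitzOnBounded.exists_common hf C
  obtain ⟨M, hM, hfM⟩ := LipschitzOnBounded.exists_common_bound hf C
  obtain ⟨A, hA, hinc⟩ := exists_norm_increment_le (C := C) hσ hP hα₀ hYc hstep
  obtain ⟨B, hB, δ, hδ⟩ := exists_distance_recursion (F := F) hσ hP hα₀ hYcl hYc hiF hrF
    hγ.adapted hC hγ.sum_sq_lt_top hξ.memLp hξ.centered (le_max_right _ _) hK hstep hprL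
    (fun x => (hpr x).1.1) hprmin
  have hmk := ae_exists_tendsto_sum_markov_noise (F := F) hiF hrF hγ.adapted hYcl hC
    hγ.sum_sq_lt_top hmarkov hξ.memLp (le_max_right _ _) hK hf
  obtain ⟨R, hR⟩ := exists_sum_integral_boundedStep_sq_le (F := F) (C := C) hYcl hrF hγ.adapted hC
    hγ.sum_sq_lt_top
  have hsq := ae_exists_tendsto_sum_sq_mul
    (stronglyMeasurable_boundedStep (F := F) hYcl hrF hγ.adapted) (abs_boundedStep_le hC) hR
    hξ.memLp (le_max_right _ _) hK
  filter_upwards [hδ, hmk, hsq, hγ.pos, hγ.tendsto_zero, hγ.sum_eq_top, hγ.variation 1 one_pos]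
    with ω ⟨⟨l₁, h₁⟩, hrec⟩ ⟨l₂, h₂⟩ ⟨l₃, h₃⟩ hpos hzero htop hvar hrC hγC
  -- Time `0` is excluded because the initial point need not lie in `Y`.
  have hmem : ∀ t ≥ 1, ω ∈ boundedEvent Y C r γ t := by
    intro t ht
    obtain ⟨t, rfl⟩ : ∃ s, t = s + 1 := ⟨t - 1, by lia⟩
    exact ⟨(hstep t ω).1, hrC _, (hpos _).le, hγC _⟩
  let g : ℕ → ℝ := fun t => boundedStep Y C r γ t ω
  let δ' : ℕ → ℝ := fun t => g t * (f (i (t + 1) ω) (r t ω) - ∑ j, P (i t ω) j * f j (r t ω))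
  let s : ℕ → ℝ := fun t => g t ^ 2 * (1 + ξ t ω ^ 2)
  let u : ℕ → ℝ := fun t => -2 * (γ t ω * f (i t ω) (r t ω))
  let H : ℕ → ℝ := fun t => 2 * (q ⬝ᵥ fun k => h k (r t ω))
  have hu : Tendsto u atTop (𝓝 0) := by
    have h0 : Tendsto (fun t => 2 * M * γ t ω) atTop (𝓝 0) := by
      simpa using hzero.const_mul (2 * M)
    refine squeeze_zero_norm (fun t => ?_) h0
    rw [Real.norm_eq_abs, abs_mul, abs_mul, abs_of_pos (hpos t)]
    have := mul_le_mul_of_nonneg_left (hfM (i t ω) _ (hrC t)) (hpos t).le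
    norm_num
    linarith
  have hconvSum : Tendsto (fun T => ∑ t ∈ Finset.range T,
      (δ t ω + (-2 * δ' t + (B + 4 * L * A) * s t))) atTop
      (𝓝 (l₁ + (-2 * l₂ + (B + 4 * L * A) * l₃))) := by
    simp only [Finset.sum_add_distrib, ← Finset.mul_sum]
    exact h₁.add ((h₂.const_mul (-2)).add (h₃.const_mul _))
  -- The error consists of a convergent series, the variation of the step sizes and a telescoping
  -- part. The coefficient has `M + 1` in place of `M` to be strictly positive.
  have hsmall : SmallOnWindows (fun t => γ t ω) fun t =>
      (δ t ω + (-2 * δ' t + (B + 4 * L * A) * s t))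
        + ((2 * (M + 1)) * |γ t ω - γ (t + 1) ω| + (u t - u (t + 1))) :=
    (SmallOnWindows.of_tendsto hpos hconvSum).add
      (((SmallOnWindows.of_variation hpos hzero hvar).const_mul (by positivity)).add
        (.of_telescope hpos hu))
  have hH0 : ∀ t, 0 ≤ H t := fun t => by
    refine mul_nonneg zero_le_two (le_trans ?_ (mul_sum_sq_le_sum_driftTerm hσ hP hac hq hqs hqP
      hα₀ hv hprv (r t ω)))
    exact mul_nonneg (by linarith) (Finset.sum_nonneg fun j _ => by have := hq j; positivity)
  refine tendsto_zero_of_drift (H := H) (N₀ := 1) hpos hzero htop hsmall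
    (fun t => sq_nonneg _) hH0 (fun η hη => ?_) fun t ht => ?_
  · obtain ⟨d, hd, hlow⟩ := exists_drift_lower_bound hσ hP hac hq hqs hqP hα₀ hcontr hv hYcl hprL
      hprv hprfix C hη
    refine ⟨2 * d, by positivity, 1, fun t ht hη' => ?_⟩
    exact mul_le_mul_of_nonneg_left (hlow _ (hmem t ht).1 (hrC t) hη') zero_le_two
  · have hr1 := hrec t (hmem t ht) (hmem (t + 1) (by lia))
    have hgt : g t = γ t ω := boundedStep_of_mem (hmem t ht)
    have hpois : h (i t ω) (r t ω) - q ⬝ᵥ (fun k => h k (r t ω))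
        = f (i t ω) (r t ω) - ∑ j, P (i t ω) j * f j (r t ω) :=
      hZ (fun k => h k (r t ω)) (i t ω)
    -- Comparing `γ_t P f` with `γ_{t+1} f` at time `t + 1` takes three corrections: `δ'` replaces
    -- `P f` by the value at the next state, `hx1` moves the coefficients, and `hx2` changes the
    -- step size.
    have hlip : |f (i (t + 1) ω) (r (t + 1) ω) - f (i (t + 1) ω) (r t ω)|
        ≤ L * (A * (γ t ω * (1 + |ξ t ω|))) :=
      (hfL _ _ _ (hrC _) (hrC _)).trans (mul_le_mul_of_nonneg_left (hinc t ω (hmem t ht)) hL)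
    have hx1 : γ t ω * (f (i (t + 1) ω) (r t ω) - f (i (t + 1) ω) (r (t + 1) ω))
        ≤ 2 * L * A * s t := by
      have e1 := mul_le_mul_of_nonneg_left ((abs_le.1 hlip).1) (hpos t).le
      have e2 : 1 + |ξ t ω| ≤ 2 * (1 + ξ t ω ^ 2) := by
        nlinarith [sq_abs (ξ t ω), sq_nonneg (|ξ t ω| - 1), abs_nonneg (ξ t ω)]
      have e3 := mul_le_mul_of_nonneg_left e2
        (show 0 ≤ γ t ω ^ 2 * (L * A) by have := hpos t; positivity)
      simp only [s, hgt]
      linarith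
    have hx2 : (γ t ω - γ (t + 1) ω) * f (i (t + 1) ω) (r (t + 1) ω)
        ≤ (M + 1) * |γ t ω - γ (t + 1) ω| := by
      refine (le_abs_self _).trans ?_
      rw [abs_mul, mul_comm]
      exact mul_le_mul_of_nonneg_right ((hfM _ _ (hrC _)).trans (by linarith)) (abs_nonneg _)
    have hx3 : B * γ t ω ^ 2 ≤ B * s t := by
      simp only [s, hgt]
      refine mul_le_mul_of_nonneg_left (le_mul_of_one_le_right (sq_nonneg _) ?_) hB
      linarith [sq_nonneg (ξ t ω)]
    have hx4 : γ t ω * h (i t ω) (r t ω) = γ t ω * (q ⬝ᵥ fun k => h k (r t ω))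
        + γ t ω * f (i t ω) (r t ω) - γ t ω * ∑ j, P (i t ω) j * f j (r t ω) := by
      rw [← sub_add_cancel (h (i t ω) (r t ω)) (q ⬝ᵥ fun k => h k (r t ω)), hpois]
      ring
    change _ ≤ _ - 2 * (γ t ω * h (i t ω) (r t ω)) + _ + _ at hr1
    simp only [H, δ', u, hgt]
    linarith

/-- Accumulation points of a bounded sequence generated by the projected method of temporal
differences are solutions. The method without projection is the case `Y = Set.univ`. -/
theorem ae_mem_of_mapClusterPt (hσ : IsTransitionRiskMapping σ)
    (hP : ∀ i, P i ∈ stdSimplex ℝ (Fin n)) (hirr : P.IsIrreducible)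
    (hqs : q ∈ stdSimplex ℝ (Fin n)) (hqP : q ᵥ* P = q)
    (hac : ∀ i, ∀ μ ∈ riskMultikernel σ i (P i), ∀ j, P i j = 0 → μ j = 0)
    (hα₀ : 0 < α) (hcontr : α * √(1 + distortion σ P) < 1)
    (hv : IsProjectedSolution σ P q c α Φ v)
    (hi : ∀ t, Measurable (i t)) (hr : ∀ t, Measurable (r t))
    (hmarkov : IsMarkovTrajectory μ P (history i r) i)
    (hγ : StepsizeCondition μ (history i r) γ) (hξ : ErrorCondition μ (history i r) ξ)
    (hYcl : IsClosed Y) (hYc : Convex ℝ Y) (hYne : ∃ y ∈ Y, approxValue Φ y = v)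
    (hstep : ∀ t ω, IsArgmin (fun z => ‖z - (r t ω - (γ t ω *
      (exactDiff σ P c α Φ (i t ω) (r t ω) - α * ξ t ω)) • feature Φ (i t ω))‖) Y (r (t + 1) ω))
    (hbdd : ∀ᵐ ω ∂μ, ∃ C : ℝ, ∀ t, ‖r t ω‖ ≤ C) :
    ∀ᵐ ω ∂μ, ∀ x, MapClusterPt x atTop (fun t => r t ω) → x ∈ Y ∧ approxValue Φ x = v := by
  have hsol : IsClosed (Y ∩ {y | approxValue Φ y = v}) := by
    refine hYcl.inter (isClosed_eq ?_ continuous_const)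
    refine continuous_pi fun j => ?_
    simp only [approxValue_apply]
    fun_prop
  have hconv := convex_inter_approxValue_eq (Φ := Φ) (v := v) hYc
  obtain ⟨y₀, hy₀⟩ := hYne
  choose pr hpr using exists_isArgmin_norm_sub ⟨y₀, hy₀⟩ hsol hconv
  -- Integer bounds give a countable family of almost sure events covering every bounded trajectory.
  have hall := ae_all_iff.2 fun N : ℕ => ae_tendsto_distance_of_bounded hσ hP hirr hqs hqP hac
    hα₀ hcontr hv hi hr hmarkov hγ hξ hYcl hYc hstep hpr (Nat.cast_nonneg N)
  filter_upwards [hall, hbdd, hγ.tendsto_zero] with ω hω ⟨C, hC⟩ hzero x hx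
  obtain ⟨C', hC'⟩ := hzero.bddAbove_range
  obtain ⟨N, hN⟩ := exists_nat_ge (max C C')
  have hlim := hω N (fun t => (hC t).trans ((le_max_left _ _).trans hN))
    fun t => (hC' (Set.mem_range_self t)).trans ((le_max_right _ _).trans hN)
  have hcont : Continuous fun x => ‖x - pr x‖ ^ 2 := by
    have : Continuous pr := (LipschitzWith.of_dist_le_mul (K := 1) fun x y => by
      simpa [dist_eq_norm] using (hpr x).norm_sub_le hconv (hpr y)).continuous
    fun_prop
  have hcl : MapClusterPt (‖x - pr x‖ ^ 2) atTop fun t => ‖r t ω - pr (r t ω)‖ ^ 2 :=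
    hx.continuousAt_comp hcont.continuousAt
  have h0 : ‖x - pr x‖ ^ 2 = 0 := by
    by_contra hne
    exact hcl.neBot.ne ((disjoint_nhds_nhds.2 hne).mono_right hlim).eq_bot
  have hx' : x = pr x := sub_eq_zero.1 (norm_eq_zero.1 (pow_eq_zero_iff two_ne_zero |>.1 h0))
  rw [hx']
  exact (hpr x).1

end Convergence

end RiskTD

theorem mainTheorem4 {n m : ℕ}
    -- the risk mapping, the Markov system, costs, discount factor, features
    (σ : Fin n → (Fin n → ℝ) → (Fin n → ℝ) → ℝ) (hσ : RiskTD.IsTransitionRiskMapping σ)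
    (P : Matrix (Fin n) (Fin n) ℝ) (hP : ∀ i, P i ∈ stdSimplex ℝ (Fin n))
    (hirr : P.IsIrreducible)
    (q : Fin n → ℝ) (hq : q ∈ stdSimplex ℝ (Fin n)) (hqP : q ᵥ* P = q)
    (hac : ∀ i, ∀ μ ∈ RiskTD.riskMultikernel σ i (P i), ∀ j, P i j = 0 → μ j = 0)
    (c : Fin n → ℝ) (α : ℝ) (hα₀ : 0 < α) (hα₁ : α < 1)
    (Φ : Matrix (Fin n) (Fin m) ℝ)
    (hcontr : α * Real.sqrt (1 + RiskTD.distortion σ P) < 1)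
    -- the trajectory, the coefficients, step sizes, risk estimates and their errors
    {Ω : Type*} [MeasurableSpace Ω] (μ : Measure Ω) [IsProbabilityMeasure μ]
    (i : ℕ → Ω → Fin n) (r : ℕ → Ω → EuclideanSpace ℝ (Fin m))
    (γ σest ξ : ℕ → Ω → ℝ)
    (hi : ∀ t, Measurable (i t)) (hr : ∀ t, Measurable (r t))
    (hmarkov : RiskTD.IsMarkovTrajectory μ P (RiskTD.history i r) i)
    (hσest : ∀ t ω, σest t ω =
      σ (i t ω) (P (i t ω)) (RiskTD.approxValue Φ (r t ω)) + ξ t ω)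
    (hγ : RiskTD.StepsizeCondition μ (RiskTD.history i r) γ)
    (hξ : RiskTD.ErrorCondition μ (RiskTD.history i r) ξ) :
    ∃ vstar : Fin n → ℝ,
      -- `vstar` is the unique solution of the projected equation
      (RiskTD.IsProjectedSolution σ P q c α Φ vstar ∧
        ∀ v, RiskTD.IsProjectedSolution σ P q c α Φ v → v = vstar) ∧
      -- the basic method
      ((∀ t ω, r (t + 1) ω =
          RiskTD.tdStep c α Φ (i t ω) (r t ω) (σest t ω) (γ t ω)) →
        (∀ᵐ ω ∂μ, ∃ C : ℝ, ∀ t, ‖r t ω‖ ≤ C) →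
        ∀ᵐ ω ∂μ, ∀ x : EuclideanSpace ℝ (Fin m),
          MapClusterPt x atTop (fun t => r t ω) → RiskTD.approxValue Φ x = vstar) ∧
      -- the method with projection on a bounded set `Y`
      (∀ Y : Set (EuclideanSpace ℝ (Fin m)), IsClosed Y → Convex ℝ Y → Bornology.IsBounded Y →
        (∃ y ∈ Y, RiskTD.approxValue Φ y = vstar) →
        (∀ t ω, RiskTD.IsArgmin (fun z => ‖z - RiskTD.tdStep c α Φ (i t ω) (r t ω)
            (σest t ω) (γ t ω)‖) Y (r (t + 1) ω)) →
        ∀ᵐ ω ∂μ, ∀ x : EuclideanSpace ℝ (Fin m),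
          MapClusterPt x atTop (fun t => r t ω) → x ∈ Y ∧ RiskTD.approxValue Φ x = vstar) := by
  have hqpos := RiskTD.stationary_pos hP hirr hq hqP
  obtain ⟨v, hv, huniq⟩ := RiskTD.existsUnique_isProjectedSolution (c := c) (Φ := Φ) hqpos hσ hP
    hac hq hqP hα₀ hcontr
  have htd : ∀ t ω, RiskTD.tdStep c α Φ (i t ω) (r t ω) (σest t ω) (γ t ω)
      = r t ω - (γ t ω * (RiskTD.exactDiff σ P c α Φ (i t ω) (r t ω) - α * ξ t ω)) •
        RiskTD.feature Φ (i t ω) := fun t ω => by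
    rw [RiskTD.tdStep, hσest, RiskTD.tempDiff_add_noise]
  refine ⟨v, ⟨hv, huniq⟩, fun hrec hbdd => ?_, fun Y hYcl hYc hYb hYne hrec => ?_⟩
  · obtain ⟨s, hs⟩ := hv.mem_range
    -- On the whole space every point is its own projection; a coefficient vector for `v` exists
    -- because a solution lies in the range of `Φ`.
    have hmain := RiskTD.ae_mem_of_mapClusterPt (Y := Set.univ) hσ hP hirr hq hqP hac hα₀ hcontr
      hv hi hr hmarkov hγ hξ isClosed_univ convex_univ ⟨WithLp.toLp 2 s, trivial, hs⟩
      (fun t ω => by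
        rw [← htd, ← hrec]
        exact RiskTD.isArgmin_norm_sub_self trivial) hbdd
    filter_upwards [hmain] with ω h x hx using (h x hx).2
  · obtain ⟨C, hC⟩ := hYb.exists_norm_le
    refine RiskTD.ae_mem_of_mapClusterPt hσ hP hirr hq hqP hac hα₀ hcontr
      -- The bound must include `‖r 0 ω‖`, since only the later iterates are known to lie in `Y`.
      hv hi hr hmarkov hγ hξ hYcl hYc hYne (fun t ω => by
        rw [← htd]
        exact hrec t ω) (.of_forall fun ω => ⟨max ‖r 0 ω‖ C, fun t => ?_⟩)
    rcases t with _ | t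
    · exact le_max_left _ _
    · exact (hC _ (hrec t ω).1).trans (le_max_right _ _)
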